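/- There are $N$ subsystems $i\in\{1,\dots,N\}$ with plant $x_{i,k+1}=A_ix_{i,k}+B_iu_{i,k}+w_{i,k}$ and output $y_{i,k}=C_ix_{i,k}+v_{i,k}$, $k\ge 0$, where $w_{i,k}\sim\mathcal N(0,W_i)$, $v_{i,k}\sim\mathcal N(0,V_i)$ and $x_{i,0}\sim\mathcal N(\bar x_{i,0},X_i)$ are mutually independent. They share one wireless channel. A packet sent by sensor $i$ is received with probability $q_i$; the states of the links are independent over all links and frames, and independent of the initial states and of the noises. Let $Q_i,R_i$ be positive semidefinite weights; let $(A_i,B_i)$ and $(A_i,W_i^{1/2})$ be controllable and $(A_i,Q_i^{1/2})$ and $(A_i,C_i)$ be observable. Let $\Pi_i$ be the positive semidefinite solution of $$\Pi_i=A_i^T\Pi_iA_i+Q_i-L_i^T(B_i^T\Pi_iB_i+R_i)L_i,\qquad L_i=-(B_i^T\Pi_iB_i+R_i)^{-1}B_i^T\Pi_iA_i,$$ and put $\Gamma_i=L_i^T(B_i^T\Pi_iB_i+R_i)L_i$. *Sensors.* Let $h_i(Y)=A_iYA_i^T+W_i$ and $g_i(Y)=Y-YC_i^T(C_iYC_i^T+V_i)^{-1}C_iY$.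 Sensor $i$ runs the Kalman filter with a priori estimates $\hat x^s_{i,k|k-1}$ ($\hat x^s_{i,0|-1}=\bar x_{i,0}$), a posteriori estimates $\hat x^s_{i,k|k}$, and covariances $P^s_{i,0|-1}=X_i$, $P^s_{i,k|k}=g_i(P^s_{i,k|k-1})$, $P^s_{i,k+1|k}=h_i(P^s_{i,k|k})$. All inverses that occur are assumed to exist. A frame $k$ is fixed in which the filters are in steady state: $P^s_{i,k|k}=\bar P_i$ for all $i$, where $\bar P_i$ is the positive semidefinite solution of $g_i(h_i(Y))=Y$. *Estimators and controllers.* In frame $\kappa$, $\theta_{i,\kappa}\in\{0,1\}$ tells whether subsystem $i$ is triggered, $\delta_{i,\kappa}\in\{0,1\}$ whether its sensor is granted access and transmits $\hat x^s_{i,\kappa|\kappa}$, and $\gamma_{i,\kappa}\in\{0,1\}$ whether it transmits and the packet is received. The estimator uses $\hat x_{i,\kappa|\kappa}=\hat x^s_{i,\kappa|\kappa}$ if $\gamma_{i,\kappa}=1$ and otherwise the prediction $(A_i+B_iL_i)\hat x_{i,\kappa-1|\kappa-1}$ (which is read as $\bar x_{i,0}$ for $\kappa=0$). The input is $u_{i,\kappa}=L_i\hat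 x_{i,\kappa|\kappa}$, and $e_{i,\kappa|\kappa}=x_{i,\kappa}-\hat x_{i,\kappa|\kappa}$. *Information and feasible decisions.* Let $t_{i,\kappa}=\min\{\tau\ge0:\gamma_{i,\kappa-\tau}=1\}$ ($\infty$ if there is no such $\tau\le\kappa$). The decision makers in frame $\kappa$ know $\mathcal I^\kappa=\{y_{i,0},\dots,y_{i,\kappa},\,t_{i,0},\dots,t_{i,\kappa-1}: 1\le i\le N\}$. The triggers $\theta_{i,\kappa}$, $\kappa\le k$, are functions of $\mathcal I^\kappa$. A decision $(\delta_{i,\kappa})_i$ is feasible if it is a (measurable) function of $\mathcal I^\kappa$, $\delta_{i,\kappa}=1$ only if $\theta_{i,\kappa}=1$, and $\sum_i\delta_{i,\kappa}\le1$. The decisions in the frames $\kappa<k$ are given and feasible. *Problem 1.* Among all feasible decisions $(\delta_{i,k})_i$ in frame $k$, minimize (almost surely) $$\mathbb E\{J_k\mid\mathcal I^k\}=\sum_{i=1}^N\Big(\operatorname{tr}(\Pi_iW_i)+\operatorname{tr}\big(\Gamma_i\,\mathbb E\{e_{i,k|k}e_{i,k|k}^T\mid\mathcal I^k\}\big)\Big).$$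 **Proposition.** Let $\check e_{i,k|k}=\hat x^s_{i,k|k}-(A_i+B_iL_i)\hat x_{i,k-1|k-1}$ be the discrepancy between the sensor's a posteriori estimate and the estimate that the estimator uses if it receives no packet in frame $k$, let $\mathrm{VoI}_{i,k}=\operatorname{tr}(\Gamma_i\,\check e_{i,k|k}\check e_{i,k|k}^T)$, and let $\mathcal F_k=\{i:\theta_{i,k}=1\}$. Then Problem 1 is solved by letting $\delta_{i^*,k}=1$ where $$i^*\in\operatorname*{arg\,max}_{i\in\mathcal F_k}\ \mathrm{VoI}_{i,k}\,q_i$$ (and no access is granted if $\mathcal F_k=\emptyset$): feasible decisions of this form exist; for every feasible decision in frame $k$ the entries of $e_{i,k|k}e_{i,k|k}^T$ are integrable; and every feasible decision of this form attains the minimum, almost surely. -/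

import Mathlib

open MeasureTheory ProbabilityTheory Matrix

noncomputable section

/-- The data of one control loop: the plant `x⁺ = A x + B u + w`, the output `y = C x + v`, the
weights `Q`, `R` of the quadratic cost, the noise covariances `W`, `V`, the mean `x₀` and the
covariance `X` of the initial state, and the probability `q` that a packet sent over the link of
this loop is received. -/
structure Subsystem where
  n : ℕ
  m : ℕ
  p : ℕ
  A : Matrix (Fin n) (Fin n) ℝ
  B : Matrix (Fin n) (Fin m) ℝ
  C : Matrix (Fin p) (Fin n) ℝ
  Q : Matrix (Fin n) (Fin n) ℝ
  R : Matrix (Fin m) (Fin m) ℝ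
  W : Matrix (Fin n) (Fin n) ℝ
  V : Matrix (Fin p) (Fin p) ℝ
  x₀ : Fin n → ℝ
  X : Matrix (Fin n) (Fin n) ℝ
  q : ℝ

/-- `(A, B)` is controllable: the controllability matrix `[B, AB, …, Aⁿ⁻¹B]` has rank `n`. -/
def Controllable {n m : ℕ} (A : Matrix (Fin n) (Fin n) ℝ) (B : Matrix (Fin n) (Fin m) ℝ) : Prop :=
  (Matrix.of fun (a : Fin n) (c : Fin n × Fin m) => (A ^ (c.1 : ℕ) * B) a c.2).rank = n

/-- `(A, C)` is observable: the observability matrix `[C; CA; …; CAⁿ⁻¹]` has rank `n`. -/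
def Observable {n p : ℕ} (A : Matrix (Fin n) (Fin n) ℝ) (C : Matrix (Fin p) (Fin n) ℝ) : Prop :=
  (Matrix.of fun (c : Fin n × Fin p) (a : Fin n) => (C * A ^ (c.1 : ℕ)) c.2 a).rank = n

/-- `T` is the positive semidefinite square root of `M`. -/
def IsPSDSqrt {n : ℕ} (T M : Matrix (Fin n) (Fin n) ℝ) : Prop :=
  T.PosSemidef ∧ T * T = M

namespace Subsystem

variable (S : Subsystem)

/-- The standing assumptions on the matrices of a subsystem. -/
structure Regular : Prop where
  psd_W : S.W.PosSemidef
  psd_V : S.V.PosSemidef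
  psd_X : S.X.PosSemidef
  psd_Q : S.Q.PosSemidef
  psd_R : S.R.PosSemidef
  controllable_input : Controllable S.A S.B
  observable_cost : ∃ T, IsPSDSqrt T S.Q ∧ Observable S.A T
  observable_output : Observable S.A S.C
  controllable_noise : ∃ T, IsPSDSqrt T S.W ∧ Controllable S.A T

/-! Certainty equivalence controller -/

/-- The feedback gain `L = -(Bᵀ Π B + R)⁻¹ Bᵀ Π A`. -/
def fbGain (P : Matrix (Fin S.n) (Fin S.n) ℝ) : Matrix (Fin S.m) (Fin S.n) ℝ :=
  -((S.Bᵀ * P * S.B + S.R)⁻¹ * S.Bᵀ * P * S.A)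

/-- `Γ = Lᵀ (Bᵀ Π B + R) L`. -/
def errWeight (P : Matrix (Fin S.n) (Fin S.n) ℝ) : Matrix (Fin S.n) (Fin S.n) ℝ :=
  (S.fbGain P)ᵀ * (S.Bᵀ * P * S.B + S.R) * S.fbGain P

/-- `P` is a positive semidefinite solution of the control Riccati equation
`P = Aᵀ P A + Q - Lᵀ (Bᵀ P B + R) L` (whose inverse exists). -/
def IsControlRiccati (P : Matrix (Fin S.n) (Fin S.n) ℝ) : Prop :=
  P.PosSemidef ∧ IsUnit (S.Bᵀ * P * S.B + S.R) ∧
    P = S.Aᵀ * P * S.A + S.Q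
      - (S.fbGain P)ᵀ * (S.Bᵀ * P * S.B + S.R) * S.fbGain P

/-! Kalman filter of the sensor -/

/-- `h(Y) = A Y Aᵀ + W`. -/
def predictCov (Y : Matrix (Fin S.n) (Fin S.n) ℝ) : Matrix (Fin S.n) (Fin S.n) ℝ :=
  S.A * Y * S.Aᵀ + S.W

/-- The innovation covariance `C Y Cᵀ + V`. -/
def innovCov (Y : Matrix (Fin S.n) (Fin S.n) ℝ) : Matrix (Fin S.p) (Fin S.p) ℝ :=
  S.C * Y * S.Cᵀ + S.V

/-- `g(Y) = Y - Y Cᵀ (C Y Cᵀ + V)⁻¹ C Y`. -/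
def updateCov (Y : Matrix (Fin S.n) (Fin S.n) ℝ) : Matrix (Fin S.n) (Fin S.n) ℝ :=
  Y - Y * S.Cᵀ * (S.innovCov Y)⁻¹ * S.C * Y

/-- The a priori error covariance `Pˢ_{k|k-1}` of the sensor's filter; the one at time `0` is
the covariance of the initial state. -/
def priorCov : ℕ → Matrix (Fin S.n) (Fin S.n) ℝ
  | 0 => S.X
  | k + 1 => S.predictCov (S.updateCov (priorCov k))

/-- The a posteriori error covariance `Pˢ_{k|k}` of the sensor's filter. -/
def postCov (k : ℕ) : Matrix (Fin S.n) (Fin S.n) ℝ :=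
  S.updateCov (S.priorCov k)

/-- The Kalman gain `Kˢ_k`. -/
def kalmanGain (k : ℕ) : Matrix (Fin S.n) (Fin S.p) ℝ :=
  S.priorCov k * S.Cᵀ * (S.innovCov (S.priorCov k))⁻¹

/-- `P` is a positive semidefinite solution of `g (h P) = P` (whose inverse exists). -/
def IsSteadyCov (P : Matrix (Fin S.n) (Fin S.n) ℝ) : Prop :=
  P.PosSemidef ∧ IsUnit (S.innovCov (S.predictCov P)) ∧ S.updateCov (S.predictCov P) = P

/-! The closed loop along one realization of the noise and of the packet receptions -/

/-- The state of one closed loop at time `k`, before the channel is accessed. -/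
structure Frame where
  /-- the plant state `x_k` -/
  x : Fin S.n → ℝ
  /-- the sensor's a priori estimate `x̂ˢ_{k|k-1}` -/
  sPrior : Fin S.n → ℝ
  /-- the estimate that the estimator will use if it receives no packet at time `k` -/
  pred : Fin S.n → ℝ

variable {S}

/-- The output `y_k = C x_k + v_k`. -/
def Frame.y (f : S.Frame) (v : Fin S.p → ℝ) : Fin S.p → ℝ :=
  S.C *ᵥ f.x + v

/-- The sensor's a posteriori estimate
`x̂ˢ_{k|k} = x̂ˢ_{k|k-1} + K_k (y_k - C x̂ˢ_{k|k-1})`. -/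
def Frame.sPost (f : S.Frame) (k : ℕ) (v : Fin S.p → ℝ) : Fin S.n → ℝ :=
  f.sPrior + S.kalmanGain k *ᵥ (f.y v - S.C *ᵥ f.sPrior)

/-- The estimator's a posteriori estimate `x̂_{k|k}`: the content `x̂ˢ_{k|k}` of the packet if one
is received, and the prediction otherwise. -/
def Frame.est (f : S.Frame) (k : ℕ) (v : Fin S.p → ℝ) (received : Bool) : Fin S.n → ℝ :=
  if received then f.sPost k v else f.pred

variable (S)

/-- The closed loop with the control `u_k = L x̂_{k|k}`, where `L` is the gain that belongs to `P`,
driven by the initial state `x0`, the noises `w`, `v` and the packet receptions `γ`. Before the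
first packet the estimator predicts from the mean of the initial state. -/
def loop (P : Matrix (Fin S.n) (Fin S.n) ℝ) (x0 : Fin S.n → ℝ) (w : ℕ → Fin S.n → ℝ)
    (v : ℕ → Fin S.p → ℝ) (γ : ℕ → Bool) : ℕ → S.Frame
  | 0 => { x := x0, sPrior := S.x₀, pred := S.x₀ }
  | k + 1 =>
    let f := loop P x0 w v γ k
    let xe := f.est k (v k) (γ k)
    let u := S.fbGain P *ᵥ xe
    { x := S.A *ᵥ f.x + S.B *ᵥ u + w k
      sPrior := S.A *ᵥ f.sPost k (v k) + S.B *ᵥ u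
      pred := (S.A + S.B * S.fbGain P) *ᵥ xe }

/-- If the last packet before or at time `k` was received at time `k - t`, then
`x̂_{k|k} = (A + B L)ᵗ x̂ˢ_{k-t|k-t}`. -/
theorem loop_est_eq (P : Matrix (Fin S.n) (Fin S.n) ℝ) (x0 : Fin S.n → ℝ)
    (w : ℕ → Fin S.n → ℝ) (v : ℕ → Fin S.p → ℝ) (γ : ℕ → Bool) (j t : ℕ) (hj : γ j = true)
    (ht : ∀ s, j < s → s ≤ j + t → γ s = false) :
    (S.loop P x0 w v γ (j + t)).est (j + t) (v (j + t)) (γ (j + t)) =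
      (S.A + S.B * S.fbGain P) ^ t *ᵥ (S.loop P x0 w v γ j).sPost j (v j) := by
  induction t with
  | zero => simp [Frame.est, hj]
  | succ t ih =>
    have h := ht (j + (t + 1)) (by omega) le_rfl
    have ih' := ih fun s h1 h2 => ht s h1 (by omega)
    rw [h, pow_succ', ← Matrix.mulVec_mulVec, ← ih']
    simp [Frame.est, loop]

end Subsystem

/-! The stochastic model -/

/-- The sources of randomness: initial states, process noises, measurement noises, and links. -/
inductive Source (N : ℕ)
  | init (i : Fin N)
  | process (i : Fin N) (k : ℕ)
  | sensor (i : Fin N) (k : ℕ)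
  | link (i : Fin N) (k : ℕ)

/-- The space in which a source takes its values. -/
def Source.Val {N : ℕ} (S : Fin N → Subsystem) : Source N → Type
  | .init i => Fin (S i).n → ℝ
  | .process i _ => Fin (S i).n → ℝ
  | .sensor i _ => Fin (S i).p → ℝ
  | .link _ _ => Bool

instance {N : ℕ} (S : Fin N → Subsystem) : (s : Source N) → MeasurableSpace (s.Val S)
  | .init i => inferInstanceAs (MeasurableSpace (Fin (S i).n → ℝ))
  | .process i _ => inferInstanceAs (MeasurableSpace (Fin (S i).n → ℝ))
  | .sensor i _ => inferInstanceAs (MeasurableSpace (Fin (S i).p → ℝ))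
  | .link _ _ => inferInstanceAs (MeasurableSpace Bool)

/-- The random inputs of the network: the initial states `x0 i`, the noises `w i k`, `v i k`, and
the state `link i k` of the link of subsystem `i` in frame `k` (a packet sent over this link in
this frame is received if and only if it is `true`). -/
structure Inputs {N : ℕ} (S : Fin N → Subsystem) (Ω : Type*) where
  x0 : (i : Fin N) → Ω → Fin (S i).n → ℝ
  w : (i : Fin N) → ℕ → Ω → Fin (S i).n → ℝ
  v : (i : Fin N) → ℕ → Ω → Fin (S i).p → ℝ
  link : Fin N → ℕ → Ω → Bool

namespace Inputs

variable {N : ℕ} {S : Fin N → Subsystem} {Ω : Type*}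

/-- All random inputs as one family. -/
def source (ν : Inputs S Ω) : (s : Source N) → Ω → s.Val S
  | .init i => ν.x0 i
  | .process i k => ν.w i k
  | .sensor i k => ν.v i k
  | .link i k => ν.link i k

/-- The probabilistic model: `x0 i ∼ 𝒩(x₀, X)`, `w i k ∼ 𝒩(0, W)`, `v i k ∼ 𝒩(0, V)`, a link
delivers with probability `q`, and all these random inputs are mutually independent. -/
structure Model [MeasurableSpace Ω] (ν : Inputs S Ω) (μ : Measure Ω) : Prop where
  law_init : ∀ i, HasLaw (fun ω => WithLp.toLp 2 (ν.x0 i ω))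
    (multivariateGaussian (WithLp.toLp 2 (S i).x₀) (S i).X) μ
  law_process : ∀ i k, HasLaw (fun ω => WithLp.toLp 2 (ν.w i k ω))
    (multivariateGaussian 0 (S i).W) μ
  law_sensor : ∀ i k, HasLaw (fun ω => WithLp.toLp 2 (ν.v i k ω))
    (multivariateGaussian 0 (S i).V) μ
  measurable : ∀ s, Measurable (ν.source s)
  law_link : ∀ i k, μ.real {ω | ν.link i k ω = true} = (S i).q
  indep : iIndepFun ν.source μ

variable (P : (i : Fin N) → Matrix (Fin (S i).n) (Fin (S i).n) ℝ) (ν : Inputs S Ω)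
  (δ : Fin N → ℕ → Ω → Bool)

/-- `γ_{i,k}`: subsystem `i` accesses the channel in frame `k` and its packet is received. -/
def recv (i : Fin N) (k : ℕ) (ω : Ω) : Bool :=
  δ i k ω && ν.link i k ω

/-- The closed loop of subsystem `i` at time `k` under the access decisions `δ`. It depends on
`δ i κ` only for `κ < k`. -/
def frame (i : Fin N) (k : ℕ) (ω : Ω) : (S i).Frame :=
  (S i).loop (P i) (ν.x0 i ω) (fun κ => ν.w i κ ω) (fun κ => ν.v i κ ω)
    (fun κ => ν.recv δ i κ ω) k

/-- The output `y_{i,k}`. -/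
def output (i : Fin N) (k : ℕ) (ω : Ω) : Fin (S i).p → ℝ :=
  (ν.frame P δ i k ω).y (ν.v i k ω)

/-- `t_{i,k} = min {τ ≥ 0 | γ_{i,k-τ} = 1}`, the time elapsed at time `k` since the last reception
(`⊤` if no packet has been received yet). -/
def elapsed (i : Fin N) (k : ℕ) (ω : Ω) : ℕ∞ :=
  ⨅ τ ∈ {τ : ℕ | τ ≤ k ∧ ν.recv δ i (k - τ) ω = true}, (τ : ℕ∞)

/-- The information `𝓘ᵏ` of the decision makers in frame `k`: for all subsystems, the outputs
up to time `k`, and what the acknowledgements of the earlier frames have told. -/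
def info (k : ℕ) : MeasurableSpace Ω :=
  ⨆ i : Fin N,
    (⨆ κ ∈ {κ : ℕ | κ ≤ k}, MeasurableSpace.comap (ν.output P δ i κ) inferInstance) ⊔
    (⨆ κ ∈ {κ : ℕ | κ < k}, MeasurableSpace.comap (ν.elapsed δ i κ) ⊤)

/-- Given the earlier decisions `δ` and the triggers `θ`, the decision `d` is feasible in
frame `k`: it is based on the available information, only triggered subsystems transmit, and at
most one subsystem transmits. -/
structure Feasible (θ : Fin N → ℕ → Ω → Bool) (k : ℕ) (d : Fin N → Ω → Bool) : Prop where
  measurable : ∀ i, Measurable[ν.info P δ k] (d i)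
  triggered : ∀ i ω, d i ω = true → θ i k ω = true
  collision_free : ∀ ω, ∑ i, (d i ω).toNat ≤ 1

/-- The error `e_{i,k|k} = x_{i,k} - x̂_{i,k|k}` of the estimator if the decision in frame `k`
is `d`. -/
def err (k : ℕ) (d : Fin N → Ω → Bool) (i : Fin N) (ω : Ω) : Fin (S i).n → ℝ :=
  (ν.frame P δ i k ω).x - (ν.frame P δ i k ω).est k (ν.v i k ω) (d i ω && ν.link i k ω)

/-- The objective `𝔼[J_k | 𝓘ᵏ] = ∑ i, (tr (Π W) + tr (Γ 𝔼[e eᵀ | 𝓘ᵏ]))` if the decision in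
frame `k` is `d`. -/
def cost [MeasurableSpace Ω] (μ : Measure Ω) (k : ℕ) (d : Fin N → Ω → Bool) (ω : Ω) : ℝ :=
  ∑ i, ((P i * (S i).W).trace + ((S i).errWeight (P i) *
    Matrix.of fun a b =>
      (μ[fun ω' => ν.err P δ k d i ω' a * ν.err P δ k d i ω' b | ν.info P δ k]) ω).trace)

/-- The decision `d` solves the scheduling problem of frame `k`: it is feasible, and it almost
surely minimizes `𝔼[J_k | 𝓘ᵏ]` among all feasible decisions. (The conditional expectations are
those of integrable variables.) -/
def Solves [MeasurableSpace Ω] (μ : Measure Ω) (θ : Fin N → ℕ → Ω → Bool) (k : ℕ)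
    (d : Fin N → Ω → Bool) : Prop :=
  ν.Feasible P δ θ k d ∧
  ∀ d' : Fin N → Ω → Bool, ν.Feasible P δ θ k d' →
    (∀ i a b, Integrable (fun ω => ν.err P δ k d' i ω a * ν.err P δ k d' i ω b) μ) ∧
    ν.cost P δ μ k d ≤ᵐ[μ] ν.cost P δ μ k d'

/-- The discrepancy `ě_{i,k|k}` between the sensor's a posteriori estimate and the estimate that
the estimator uses if it receives no packet at time `k`. -/
def gap (i : Fin N) (k : ℕ) (ω : Ω) : Fin (S i).n → ℝ :=
  (ν.frame P δ i k ω).sPost k (ν.v i k ω) - (ν.frame P δ i k ω).pred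

/-- The value of information `VoI_{i,k} = tr (Γ ě ěᵀ)`. -/
def voi (i : Fin N) (k : ℕ) (ω : Ω) : ℝ :=
  ((S i).errWeight (P i) * vecMulVec (ν.gap P δ i k ω) (ν.gap P δ i k ω)).trace

/-- The set `𝓕_k` of the subsystems that are triggered in frame `k`. -/
def triggeredSet (θ : Fin N → ℕ → Ω → Bool) (k : ℕ) (ω : Ω) : Set (Fin N) :=
  {i | θ i k ω = true}

/-- Whenever some subsystem is triggered, `d` grants access to a triggered subsystem that
maximizes `VoI_{i,k} q_i` among the triggered ones. -/
def GrantsMaxVoI (θ : Fin N → ℕ → Ω → Bool) (k : ℕ) (d : Fin N → Ω → Bool) : Prop :=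
  ∀ ω, (triggeredSet θ k ω).Nonempty → ∃ i ∈ triggeredSet θ k ω,
    IsMaxOn (fun j => ν.voi P δ j k ω * (S j).q) (triggeredSet θ k ω) i ∧ d i ω = true

end Inputs

end

/-! The error of the estimator splits as `e = ẽ + (1 - δ λ) ě`, where `ẽ = x - x̂ˢ` is the sensor's
a posteriori error, `λ` the state of the link, and `ě` the gap between the sensor's estimate and the
prediction (`err_eq`). Three facts determine its conditional second moment.

The input cancels in the filter errors, so `ẽ` and the innovations are linear in the centred noises,
whatever the schedule. They are jointly Gaussian, and the orthogonality property of the Kalman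
filter (`crossCov_postErr_innov`) becomes independence of `ẽ` from the innovations up to frame `k`
and, since the links are independent of the noises, from `history` (`indep_postErr_history`).

The gap `ě` is a function of the information `𝓘ᵏ` (`measurable_gap_info`), and `𝓘ᵏ` is contained in
`history`: decisions and information depend on each other, but induction over the frames resolves
the circle (`info_le`).

The link in frame `k` is independent of `𝓘ᵏ` (`condExp_link`).

Hence the cross terms vanish, and `(1 - δ λ)² = 1 - δ λ` gives `𝔼[e eᵀ | 𝓘ᵏ] = 𝔼[ẽ ẽᵀ | 𝓘ᵏ] + (1 - δ
q) ě ěᵀ` (`condExp_err_mul_err`). The first term is common to all decisions and need not be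
evaluated. What remains is to maximize `∑ δ VoI q` (`cost_eq`): at most one summand can be selected
and all are nonnegative, so a largest admissible one is optimal, realization by realization
(`sum_voi_le`). -/

/-! ### Gaussian processes and independence -/

section Gaussian

variable {Ω S T : Type*} {mΩ : MeasurableSpace Ω} {μ : Measure Ω}

/-- Linear combinations of the values of a Gaussian process form a Gaussian process. -/
theorem isGaussianProcess_of_mem_span {X : T → Ω → ℝ} (hX : IsGaussianProcess X μ)
    {Y : S → Ω → ℝ} (h : ∀ s, Y s ∈ Submodule.span ℝ (Set.range X)) : IsGaussianProcess Y μ := by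
  refine hX.of_isGaussianProcess fun s => ?_
  obtain ⟨c, hc⟩ := Finsupp.mem_span_range_iff_exists_finsupp.1 (h s)
  refine ⟨c.support, ∑ t : c.support, c t • ContinuousLinearMap.proj (R := ℝ) t, fun ω => ?_⟩
  rw [← hc, Finsupp.sum, Finset.sum_apply, ← Finset.sum_coe_sort]
  simp

/-- The coordinates of independent Gaussian vectors form a Gaussian process. -/
theorem isGaussianProcess_coord {n : T → ℕ} {X : (t : T) → Ω → Fin (n t) → ℝ}
    (hX : ∀ t, HasGaussianLaw (X t) μ) (hind : iIndepFun X μ) :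
    IsGaussianProcess (fun (p : (t : T) × Fin (n t)) ω => X p.1 ω p.2) μ where
  hasGaussianLaw I := by
    classical
    -- A finite set of coordinates meets only finitely many vectors; those are jointly Gaussian by
    -- independence, and `L` selects the coordinates.
    let J : Finset T := I.image Sigma.fst
    have h1 : HasGaussianLaw (fun ω (t : J) => X t ω) μ :=
      iIndepFun.hasGaussianLaw (fun t : J => hX t)
        (hind.precomp (g := fun t : J => (t : T)) Subtype.val_injective)
    let L : ((t : J) → Fin (n t) → ℝ) →L[ℝ] (I → ℝ) :=
      { toFun x p := x ⟨p.1.1, Finset.mem_image_of_mem _ p.2⟩ p.1.2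
        map_add' x y := by ext; simp
        map_smul' c x := by ext; simp }
    exact h1.map L

theorem integral_eq_zero_of_mem_span {X : T → Ω → ℝ} (hX : ∀ t, Integrable (X t) μ)
    (h0 : ∀ t, ∫ ω, X t ω ∂μ = 0) {Y : Ω → ℝ} (h : Y ∈ Submodule.span ℝ (Set.range X)) :
    ∫ ω, Y ω ∂μ = 0 := by
  -- Integrability is carried through the induction because additivity of the integral needs it.
  suffices Integrable Y μ ∧ ∫ ω, Y ω ∂μ = 0 from this.2
  induction h using Submodule.span_induction with
  | mem x hx => obtain ⟨t, rfl⟩ := hx; exact ⟨hX t, h0 t⟩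
  | zero => exact ⟨integrable_zero _ _ _, by simp⟩
  | add x y _ _ hx hy => exact ⟨hx.1.add hy.1, by
      simp only [Pi.add_apply]; rw [integral_add hx.1 hy.1, hx.2, hy.2, add_zero]⟩
  | smul c x _ hx => exact ⟨hx.1.smul c, by
      simp only [Pi.smul_apply]; rw [integral_smul, hx.2, smul_zero]⟩

/-- If `X` is independent of `Y` and `(X, Y)` is independent of `Z`, then `X` is independent
of `(Y, Z)`. -/
theorem indepFun_prodMk_of_indepFun {α β γ : Type*} [MeasurableSpace α] [MeasurableSpace β]
    [MeasurableSpace γ] [IsProbabilityMeasure μ] {X : Ω → α} {Y : Ω → β} {Z : Ω → γ}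
    (hX : Measurable X) (hY : Measurable Y) (hZ : Measurable Z) (hXY : IndepFun X Y μ)
    (hXYZ : IndepFun (fun ω => (X ω, Y ω)) Z μ) : IndepFun X (fun ω => (Y ω, Z ω)) μ := by
  have hYZ : IndepFun Y Z μ := hXYZ.comp measurable_snd measurable_id
  have := Measure.isProbabilityMeasure_map hX.aemeasurable (μ := μ)
  have := Measure.isProbabilityMeasure_map hY.aemeasurable (μ := μ)
  have := Measure.isProbabilityMeasure_map hZ.aemeasurable (μ := μ)
  rw [indepFun_iff_map_prod_eq_prod_map_map (by fun_prop) (by fun_prop)] at *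
  -- Both sides are the threefold product of the marginal laws, up to reassociation.
  rw [hYZ, ← Measure.prodAssoc_prod, ← hXY, ← hXYZ,
    Measure.map_map (by fun_prop) (by fun_prop)]
  rfl

end Gaussian

/-! ### Calculus of cross-covariance matrices -/

section CrossCov

variable {Ω : Type*} {mΩ : MeasurableSpace Ω} {l m n : ℕ}

/-- The cross-covariance matrix of two random vectors. -/
noncomputable def crossCov (μ : Measure Ω) (X : Ω → Fin m → ℝ) (Y : Ω → Fin n → ℝ) :
    Matrix (Fin m) (Fin n) ℝ :=
  Matrix.of fun a b => cov[fun ω => X ω a, fun ω => Y ω b; μ]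

/-- All coordinates of a random vector are square integrable. -/
def SquareIntegrable (μ : Measure Ω) (X : Ω → Fin m → ℝ) : Prop :=
  ∀ a, MemLp (fun ω => X ω a) 2 μ

variable {μ : Measure Ω} {X X' : Ω → Fin m → ℝ} {Y : Ω → Fin n → ℝ}

theorem SquareIntegrable.add (hX : SquareIntegrable μ X) (hX' : SquareIntegrable μ X') :
    SquareIntegrable μ fun ω => X ω + X' ω :=
  fun a => (hX a).add (hX' a)

theorem SquareIntegrable.sub (hX : SquareIntegrable μ X) (hX' : SquareIntegrable μ X') :
    SquareIntegrable μ fun ω => X ω - X' ω :=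
  fun a => (hX a).sub (hX' a)

theorem SquareIntegrable.mulVec (hX : SquareIntegrable μ X) (A : Matrix (Fin l) (Fin m) ℝ) :
    SquareIntegrable μ fun ω => A *ᵥ X ω := fun a => by
  simp only [Matrix.mulVec, dotProduct]
  exact memLp_finsetSum _ fun b _ => (hX b).const_mul _

theorem crossCov_transpose (X : Ω → Fin m → ℝ) (Y : Ω → Fin n → ℝ) :
    (crossCov μ X Y)ᵀ = crossCov μ Y X := by
  ext a b
  exact covariance_comm ..

theorem crossCov_comm_eq_zero (h : crossCov μ X Y = 0) : crossCov μ Y X = 0 := by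
  rw [← crossCov_transpose, h, Matrix.transpose_zero]

theorem crossCov_eq_zero_of_indepFun (h : IndepFun X Y μ) (hX : SquareIntegrable μ X)
    (hY : SquareIntegrable μ Y) : crossCov μ X Y = 0 := by
  ext a b
  exact (h.comp (measurable_pi_apply a) (measurable_pi_apply b)).covariance_eq_zero (hX a) (hY b)

variable [IsProbabilityMeasure μ]

theorem crossCov_add_left (hX : SquareIntegrable μ X) (hX' : SquareIntegrable μ X')
    (hY : SquareIntegrable μ Y) :
    crossCov μ (fun ω => X ω + X' ω) Y = crossCov μ X Y + crossCov μ X' Y := by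
  ext a b
  exact covariance_add_left (hX a) (hX' a) (hY b)

theorem crossCov_sub_left (hX : SquareIntegrable μ X) (hX' : SquareIntegrable μ X')
    (hY : SquareIntegrable μ Y) :
    crossCov μ (fun ω => X ω - X' ω) Y = crossCov μ X Y - crossCov μ X' Y := by
  ext a b
  exact covariance_sub_left (hX a) (hX' a) (hY b)

theorem crossCov_mulVec_left (hX : SquareIntegrable μ X) (hY : SquareIntegrable μ Y)
    (A : Matrix (Fin l) (Fin m) ℝ) :
    crossCov μ (fun ω => A *ᵥ X ω) Y = A * crossCov μ X Y := by
  ext a b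
  simp only [crossCov, Matrix.of_apply, Matrix.mul_apply, Matrix.mulVec, dotProduct]
  rw [covariance_fun_sum_left (fun c => (hX c).const_mul _) (hY b)]
  simp_rw [covariance_const_mul_left]

end CrossCov

/-! ### Filter errors without the control -/

namespace Subsystem

variable (S : Subsystem)

/-- The a priori estimation error `x_k - x̂ˢ_{k|k-1}` of the sensor's filter, as a function of the
initial error and of the noises; it does not depend on the control. -/
noncomputable def priorErr (e₀ : Fin S.n → ℝ) (w : ℕ → Fin S.n → ℝ) (v : ℕ → Fin S.p → ℝ) :
    ℕ → Fin S.n → ℝ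
  | 0 => e₀
  | k + 1 => S.A *ᵥ (priorErr e₀ w v k - S.kalmanGain k *ᵥ (S.C *ᵥ priorErr e₀ w v k + v k)) + w k

/-- The innovation `y_k - C x̂ˢ_{k|k-1}`. -/
noncomputable def innov (e₀ : Fin S.n → ℝ) (w : ℕ → Fin S.n → ℝ) (v : ℕ → Fin S.p → ℝ) (k : ℕ) :
    Fin S.p → ℝ :=
  S.C *ᵥ S.priorErr e₀ w v k + v k

/-- The a posteriori estimation error `x_k - x̂ˢ_{k|k}`. -/
noncomputable def postErr (e₀ : Fin S.n → ℝ) (w : ℕ → Fin S.n → ℝ) (v : ℕ → Fin S.p → ℝ) (k : ℕ) :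
    Fin S.n → ℝ :=
  S.priorErr e₀ w v k - S.kalmanGain k *ᵥ S.innov e₀ w v k

theorem priorErr_succ (e₀ : Fin S.n → ℝ) (w : ℕ → Fin S.n → ℝ) (v : ℕ → Fin S.p → ℝ) (k : ℕ) :
    S.priorErr e₀ w v (k + 1) = S.A *ᵥ S.postErr e₀ w v k + w k := rfl

section Loop

variable (P : Matrix (Fin S.n) (Fin S.n) ℝ) (x0 : Fin S.n → ℝ) (w : ℕ → Fin S.n → ℝ)
  (v : ℕ → Fin S.p → ℝ) (γ : ℕ → Bool)

/-- Plant and sensor filter receive the same input `B u`, which cancels in the difference. The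
receptions `γ` enter only through `u`, so the schedule has no influence on the error. -/
theorem loop_x_sub_sPrior (k : ℕ) :
    (S.loop P x0 w v γ k).x - (S.loop P x0 w v γ k).sPrior = S.priorErr (x0 - S.x₀) w v k := by
  induction k with
  | zero => rfl
  | succ k ih =>
    simp only [loop, priorErr, Frame.sPost, Frame.y, ← ih, Matrix.mulVec_add, Matrix.mulVec_sub]
    abel

theorem loop_y_sub (k : ℕ) :
    (S.loop P x0 w v γ k).y (v k) - S.C *ᵥ (S.loop P x0 w v γ k).sPrior =
      S.innov (x0 - S.x₀) w v k := by
  rw [innov, ← S.loop_x_sub_sPrior P x0 w v γ k, Frame.y, Matrix.mulVec_sub]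
  abel

theorem loop_sPost (k : ℕ) :
    (S.loop P x0 w v γ k).sPost k (v k) = (S.loop P x0 w v γ k).sPrior +
      S.kalmanGain k *ᵥ S.innov (x0 - S.x₀) w v k := by
  rw [← S.loop_y_sub P x0 w v γ k, Frame.sPost]

theorem loop_x_sub_sPost (k : ℕ) :
    (S.loop P x0 w v γ k).x - (S.loop P x0 w v γ k).sPost k (v k) =
      S.postErr (x0 - S.x₀) w v k := by
  rw [loop_sPost, postErr, ← S.loop_x_sub_sPrior P x0 w v γ k]
  abel

end Loop

/-- Membership in a space of scalar random variables passes from the initial error and the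
noises to the coordinates of the filter errors and of the innovations. -/
theorem filter_mem_submodule {Ω : Type*} {e₀ : Ω → Fin S.n → ℝ} {w : ℕ → Ω → Fin S.n → ℝ}
    {v : ℕ → Ω → Fin S.p → ℝ} {M : Submodule ℝ (Ω → ℝ)} (h0 : ∀ a, (fun ω => e₀ ω a) ∈ M)
    (hw : ∀ k a, (fun ω => w k ω a) ∈ M) (hv : ∀ k a, (fun ω => v k ω a) ∈ M) (k : ℕ) :
    (∀ a, (fun ω => S.priorErr (e₀ ω) (w · ω) (v · ω) k a) ∈ M) ∧
    (∀ a, (fun ω => S.innov (e₀ ω) (w · ω) (v · ω) k a) ∈ M) ∧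
    (∀ a, (fun ω => S.postErr (e₀ ω) (w · ω) (v · ω) k a) ∈ M) := by
  have hmul {m n : ℕ} (A : Matrix (Fin m) (Fin n) ℝ) (X : Ω → Fin n → ℝ)
      (hX : ∀ a, (fun ω => X ω a) ∈ M) (a : Fin m) : (fun ω => (A *ᵥ X ω) a) ∈ M := by
    have : (fun ω => (A *ᵥ X ω) a) = ∑ b, A a b • fun ω => X ω b := by
      ext ω
      simp [Matrix.mulVec, dotProduct]
    rw [this]
    exact M.sum_mem fun b _ => M.smul_mem _ (hX b)
  have hinnov (k : ℕ) (h : ∀ a, (fun ω => S.priorErr (e₀ ω) (w · ω) (v · ω) k a) ∈ M) (a) :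
      (fun ω => S.innov (e₀ ω) (w · ω) (v · ω) k a) ∈ M :=
    M.add_mem (hmul S.C _ h a) (hv k a)
  have hpost (k : ℕ) (h : ∀ a, (fun ω => S.priorErr (e₀ ω) (w · ω) (v · ω) k a) ∈ M) (a) :
      (fun ω => S.postErr (e₀ ω) (w · ω) (v · ω) k a) ∈ M :=
    M.sub_mem (h a) (hmul (S.kalmanGain k) _ (hinnov k h) a)
  have hprior : ∀ a, (fun ω => S.priorErr (e₀ ω) (w · ω) (v · ω) k a) ∈ M := by
    induction k with
    | zero => exact h0
    | succ k ih => exact fun a => M.add_mem (hmul S.A _ (hpost k ih) a) (hw k a)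
  exact ⟨hprior, hinnov k hprior, hpost k hprior⟩

/-! ### Orthogonality of the Kalman filter -/

/-- The second-order description of the initial error and of the noises of a subsystem. -/
structure WhiteNoise {Ω : Type*} [MeasurableSpace Ω] (μ : Measure Ω) (e₀ : Ω → Fin S.n → ℝ)
    (w : ℕ → Ω → Fin S.n → ℝ) (v : ℕ → Ω → Fin S.p → ℝ) : Prop where
  init : SquareIntegrable μ e₀
  process : ∀ k, SquareIntegrable μ (w k)
  sensor : ∀ k, SquareIntegrable μ (v k)
  init_init : crossCov μ e₀ e₀ = S.X
  process_process : ∀ k, crossCov μ (w k) (w k) = S.W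
  sensor_sensor : ∀ k, crossCov μ (v k) (v k) = S.V
  init_process : ∀ k, crossCov μ e₀ (w k) = 0
  init_sensor : ∀ k, crossCov μ e₀ (v k) = 0
  process_process_ne : ∀ j k, j ≠ k → crossCov μ (w j) (w k) = 0
  sensor_sensor_ne : ∀ j k, j ≠ k → crossCov μ (v j) (v k) = 0
  process_sensor : ∀ j k, crossCov μ (w j) (v k) = 0

namespace WhiteNoise

variable {S} {Ω : Type*} [MeasurableSpace Ω] {μ : Measure Ω} [IsProbabilityMeasure μ]
  {e₀ : Ω → Fin S.n → ℝ} {w : ℕ → Ω → Fin S.n → ℝ} {v : ℕ → Ω → Fin S.p → ℝ}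

omit [IsProbabilityMeasure μ] in
theorem squareIntegrable_priorErr (h : S.WhiteNoise μ e₀ w v) (k : ℕ) :
    SquareIntegrable μ fun ω => S.priorErr (e₀ ω) (w · ω) (v · ω) k := by
  induction k with
  | zero => exact h.init
  | succ k ih =>
    exact ((ih.sub (((ih.mulVec _).add (h.sensor k)).mulVec _)).mulVec _).add (h.process k)

omit [IsProbabilityMeasure μ] in
theorem squareIntegrable_innov (h : S.WhiteNoise μ e₀ w v) (k : ℕ) :
    SquareIntegrable μ fun ω => S.innov (e₀ ω) (w · ω) (v · ω) k :=
  ((h.squareIntegrable_priorErr k).mulVec _).add (h.sensor k)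

omit [IsProbabilityMeasure μ] in
theorem squareIntegrable_postErr (h : S.WhiteNoise μ e₀ w v) (k : ℕ) :
    SquareIntegrable μ fun ω => S.postErr (e₀ ω) (w · ω) (v · ω) k :=
  (h.squareIntegrable_priorErr k).sub ((h.squareIntegrable_innov k).mulVec _)

section Uncorrelated

variable {m : ℕ} {U : Ω → Fin m → ℝ}

/-- By linearity, the filter recursion becomes a recursion for cross-covariances with a fixed vector
`U`. This identity and its two analogues below carry all later computations. -/
theorem crossCov_innov_left (h : S.WhiteNoise μ e₀ w v) (hU : SquareIntegrable μ U) (k : ℕ) :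
    crossCov μ (fun ω => S.innov (e₀ ω) (w · ω) (v · ω) k) U =
      S.C * crossCov μ (fun ω => S.priorErr (e₀ ω) (w · ω) (v · ω) k) U + crossCov μ (v k) U := by
  simp only [innov]
  rw [crossCov_add_left ((h.squareIntegrable_priorErr k).mulVec _) (h.sensor k) hU,
    crossCov_mulVec_left (h.squareIntegrable_priorErr k) hU]

theorem crossCov_postErr_left (h : S.WhiteNoise μ e₀ w v) (hU : SquareIntegrable μ U) (k : ℕ) :
    crossCov μ (fun ω => S.postErr (e₀ ω) (w · ω) (v · ω) k) U =
      crossCov μ (fun ω => S.priorErr (e₀ ω) (w · ω) (v · ω) k) U -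
        S.kalmanGain k * crossCov μ (fun ω => S.innov (e₀ ω) (w · ω) (v · ω) k) U := by
  simp only [postErr]
  rw [crossCov_sub_left (h.squareIntegrable_priorErr k) ((h.squareIntegrable_innov k).mulVec _) hU,
    crossCov_mulVec_left (h.squareIntegrable_innov k) hU]

theorem crossCov_priorErr_succ_left (h : S.WhiteNoise μ e₀ w v) (hU : SquareIntegrable μ U)
    (k : ℕ) :
    crossCov μ (fun ω => S.priorErr (e₀ ω) (w · ω) (v · ω) (k + 1)) U =
      S.A * crossCov μ (fun ω => S.postErr (e₀ ω) (w · ω) (v · ω) k) U + crossCov μ (w k) U := by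
  simp only [priorErr_succ]
  rw [crossCov_add_left ((h.squareIntegrable_postErr k).mulVec _) (h.process k) hU,
    crossCov_mulVec_left (h.squareIntegrable_postErr k) hU]

/-- A random vector that is uncorrelated with the initial error and with the noises before time
`k` is uncorrelated with the a priori error at time `k`. -/
theorem crossCov_priorErr_eq_zero (h : S.WhiteNoise μ e₀ w v) (hU : SquareIntegrable μ U)
    (h0 : crossCov μ e₀ U = 0) (k : ℕ) (hw : ∀ j < k, crossCov μ (w j) U = 0)
    (hv : ∀ j < k, crossCov μ (v j) U = 0) :
    crossCov μ (fun ω => S.priorErr (e₀ ω) (w · ω) (v · ω) k) U = 0 := by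
  induction k with
  | zero => exact h0
  | succ k ih =>
    have ih := ih (fun j hj => hw j (hj.trans k.lt_succ_self))
      (fun j hj => hv j (hj.trans k.lt_succ_self))
    rw [h.crossCov_priorErr_succ_left hU, h.crossCov_postErr_left hU, h.crossCov_innov_left hU, ih,
      hw k k.lt_succ_self, hv k k.lt_succ_self]
    simp

theorem crossCov_innov_eq_zero (h : S.WhiteNoise μ e₀ w v) (hU : SquareIntegrable μ U)
    (h0 : crossCov μ e₀ U = 0) (hw : ∀ j, crossCov μ (w j) U = 0)
    (hv : ∀ j, crossCov μ (v j) U = 0) (k : ℕ) :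
    crossCov μ (fun ω => S.innov (e₀ ω) (w · ω) (v · ω) k) U = 0 := by
  rw [h.crossCov_innov_left hU, h.crossCov_priorErr_eq_zero hU h0 k (fun j _ => hw j)
    (fun j _ => hv j), hv]
  simp

theorem crossCov_postErr_eq_zero (h : S.WhiteNoise μ e₀ w v) (hU : SquareIntegrable μ U)
    (h0 : crossCov μ e₀ U = 0) (hw : ∀ j, crossCov μ (w j) U = 0)
    (hv : ∀ j, crossCov μ (v j) U = 0) (k : ℕ) :
    crossCov μ (fun ω => S.postErr (e₀ ω) (w · ω) (v · ω) k) U = 0 := by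
  rw [h.crossCov_postErr_left hU, h.crossCov_innov_eq_zero hU h0 hw hv,
    h.crossCov_priorErr_eq_zero hU h0 k (fun j _ => hw j) (fun j _ => hv j)]
  simp

end Uncorrelated

/-- The a priori error at time `k` contains the measurement noises only strictly before `k`. -/
theorem crossCov_priorErr_sensor (h : S.WhiteNoise μ e₀ w v) (k : ℕ) :
    crossCov μ (fun ω => S.priorErr (e₀ ω) (w · ω) (v · ω) k) (v k) = 0 :=
  h.crossCov_priorErr_eq_zero (h.sensor k) (h.init_sensor k) k (fun j _ => h.process_sensor j k)
    (fun j hj => h.sensor_sensor_ne j k hj.ne)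

/-- The measurement update at time `k` adds only `v k`; the process noise `w k` first enters at time
`k + 1`. -/
theorem crossCov_postErr_process (h : S.WhiteNoise μ e₀ w v) (k : ℕ) :
    crossCov μ (fun ω => S.postErr (e₀ ω) (w · ω) (v · ω) k) (w k) = 0 := by
  have h1 := h.crossCov_priorErr_eq_zero (h.process k) (h.init_process k) k
    (fun j hj => h.process_process_ne j k hj.ne)
    (fun j _ => crossCov_comm_eq_zero (h.process_sensor k j))
  rw [h.crossCov_postErr_left (h.process k), h.crossCov_innov_left (h.process k), h1,
    crossCov_comm_eq_zero (h.process_sensor k k)]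
  simp

theorem crossCov_priorErr_innov (h : S.WhiteNoise μ e₀ w v) (k : ℕ) :
    crossCov μ (fun ω => S.priorErr (e₀ ω) (w · ω) (v · ω) k)
        (fun ω => S.innov (e₀ ω) (w · ω) (v · ω) k) =
      crossCov μ (fun ω => S.priorErr (e₀ ω) (w · ω) (v · ω) k)
        (fun ω => S.priorErr (e₀ ω) (w · ω) (v · ω) k) * S.Cᵀ := by
  rw [← crossCov_transpose, h.crossCov_innov_left (h.squareIntegrable_priorErr k),
    crossCov_comm_eq_zero (h.crossCov_priorErr_sensor k), add_zero, transpose_mul,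
    crossCov_transpose]

theorem crossCov_innov_innov (h : S.WhiteNoise μ e₀ w v) (k : ℕ) :
    crossCov μ (fun ω => S.innov (e₀ ω) (w · ω) (v · ω) k)
        (fun ω => S.innov (e₀ ω) (w · ω) (v · ω) k) =
      S.innovCov (crossCov μ (fun ω => S.priorErr (e₀ ω) (w · ω) (v · ω) k)
        (fun ω => S.priorErr (e₀ ω) (w · ω) (v · ω) k)) := by
  have hv : crossCov μ (v k) (fun ω => S.innov (e₀ ω) (w · ω) (v · ω) k) = S.V := by
    rw [← crossCov_transpose, h.crossCov_innov_left (h.sensor k), h.crossCov_priorErr_sensor,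
      Matrix.mul_zero, zero_add, crossCov_transpose, h.sensor_sensor]
  rw [h.crossCov_innov_left (h.squareIntegrable_innov k), h.crossCov_priorErr_innov, hv, innovCov,
    Matrix.mul_assoc]

/-- The a posteriori error is uncorrelated with the current innovation. -/
theorem crossCov_postErr_innov_self (h : S.WhiteNoise μ e₀ w v) {k : ℕ}
    (hcov : crossCov μ (fun ω => S.priorErr (e₀ ω) (w · ω) (v · ω) k)
        (fun ω => S.priorErr (e₀ ω) (w · ω) (v · ω) k) = S.priorCov k)
    (hinv : IsUnit (S.innovCov (S.priorCov k))) :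
    crossCov μ (fun ω => S.postErr (e₀ ω) (w · ω) (v · ω) k)
      (fun ω => S.innov (e₀ ω) (w · ω) (v · ω) k) = 0 := by
  -- The gain is chosen for exactly this: `Y Cᵀ - K (C Y Cᵀ + V) = 0` for the a priori covariance
  -- `Y`.
  rw [h.crossCov_postErr_left (h.squareIntegrable_innov k), h.crossCov_innov_innov,
    h.crossCov_priorErr_innov, hcov, kalmanGain,
    Matrix.nonsing_inv_mul_cancel_right _ _ ((Matrix.isUnit_iff_isUnit_det _).1 hinv), sub_self]

/-- Orthogonality to the innovation removes the correction term from one of the two factors, so the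
a posteriori covariance equals the cross-covariance with the a priori error, `Y - K C Y` up to
transposition. -/
theorem crossCov_postErr_self (h : S.WhiteNoise μ e₀ w v) {k : ℕ}
    (hcov : crossCov μ (fun ω => S.priorErr (e₀ ω) (w · ω) (v · ω) k)
        (fun ω => S.priorErr (e₀ ω) (w · ω) (v · ω) k) = S.priorCov k)
    (hinv : IsUnit (S.innovCov (S.priorCov k))) :
    crossCov μ (fun ω => S.postErr (e₀ ω) (w · ω) (v · ω) k)
      (fun ω => S.postErr (e₀ ω) (w · ω) (v · ω) k) = S.postCov k := by
  have hinnov : crossCov μ (fun ω => S.innov (e₀ ω) (w · ω) (v · ω) k)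
      (fun ω => S.priorErr (e₀ ω) (w · ω) (v · ω) k) = S.C * S.priorCov k := by
    rw [h.crossCov_innov_left (h.squareIntegrable_priorErr k), hcov,
      crossCov_comm_eq_zero (h.crossCov_priorErr_sensor k), add_zero]
  rw [h.crossCov_postErr_left (h.squareIntegrable_postErr k),
    crossCov_comm_eq_zero (h.crossCov_postErr_innov_self hcov hinv), Matrix.mul_zero, sub_zero,
    ← crossCov_transpose, h.crossCov_postErr_left (h.squareIntegrable_priorErr k), hinnov, hcov,
    postCov, updateCov, kalmanGain, transpose_sub]
  have hsymm : (S.priorCov k)ᵀ = S.priorCov k := by rw [← hcov, crossCov_transpose]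
  have hV : S.Vᵀ = S.V := by rw [← h.sensor_sensor k, crossCov_transpose]
  simp only [innovCov, transpose_mul, transpose_nonsing_inv, transpose_add, transpose_transpose,
    hsymm, hV, Matrix.mul_assoc]

/-- The a posteriori error is uncorrelated with the innovations up to the present if the a priori
error is uncorrelated with the earlier ones. -/
theorem crossCov_postErr_innov_of_priorErr (h : S.WhiteNoise μ e₀ w v) {k : ℕ}
    (hcov : crossCov μ (fun ω => S.priorErr (e₀ ω) (w · ω) (v · ω) k)
        (fun ω => S.priorErr (e₀ ω) (w · ω) (v · ω) k) = S.priorCov k)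
    (hinv : IsUnit (S.innovCov (S.priorCov k)))
    (horth : ∀ j < k, crossCov μ (fun ω => S.priorErr (e₀ ω) (w · ω) (v · ω) k)
        (fun ω => S.innov (e₀ ω) (w · ω) (v · ω) j) = 0) :
    ∀ j ≤ k, crossCov μ (fun ω => S.postErr (e₀ ω) (w · ω) (v · ω) k)
        (fun ω => S.innov (e₀ ω) (w · ω) (v · ω) j) = 0 := by
  intro j hj
  obtain rfl | hj := hj.eq_or_lt
  · exact h.crossCov_postErr_innov_self hcov hinv
  -- An innovation at time `j < k` contains measurement noises only up to time `j`.
  have hv : crossCov μ (fun ω => S.innov (e₀ ω) (w · ω) (v · ω) j) (v k) = 0 := by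
    rw [h.crossCov_innov_left (h.sensor k), h.sensor_sensor_ne j k hj.ne,
      h.crossCov_priorErr_eq_zero (h.sensor k) (h.init_sensor k) j
        (fun i _ => h.process_sensor i k) (fun i hi => h.sensor_sensor_ne i k (hi.trans hj).ne)]
    simp
  rw [h.crossCov_postErr_left (h.squareIntegrable_innov j),
    h.crossCov_innov_left (h.squareIntegrable_innov j), horth j hj, crossCov_comm_eq_zero hv]
  simp

/-- The orthogonality properties of the Kalman filter: the a priori error has covariance
`Pˢ_{k|k-1}` and is uncorrelated with the earlier innovations. -/
theorem crossCov_priorErr (h : S.WhiteNoise μ e₀ w v) (k : ℕ)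
    (hinv : ∀ j < k, IsUnit (S.innovCov (S.priorCov j))) :
    crossCov μ (fun ω => S.priorErr (e₀ ω) (w · ω) (v · ω) k)
        (fun ω => S.priorErr (e₀ ω) (w · ω) (v · ω) k) = S.priorCov k ∧
      ∀ j < k, crossCov μ (fun ω => S.priorErr (e₀ ω) (w · ω) (v · ω) k)
        (fun ω => S.innov (e₀ ω) (w · ω) (v · ω) j) = 0 := by
  induction k with
  | zero => exact ⟨h.init_init, fun j hj => absurd hj j.not_lt_zero⟩
  | succ k ih =>
    obtain ⟨hcov, horth⟩ := ih fun j hj => hinv j (hj.trans k.lt_succ_self)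
    have hk := hinv k k.lt_succ_self
    constructor
    · have hw : crossCov μ (w k) (fun ω => S.priorErr (e₀ ω) (w · ω) (v · ω) (k + 1)) = S.W := by
        rw [← crossCov_transpose, h.crossCov_priorErr_succ_left (h.process k),
          h.crossCov_postErr_process, Matrix.mul_zero, zero_add, crossCov_transpose,
          h.process_process]
      have hpost : crossCov μ (fun ω => S.postErr (e₀ ω) (w · ω) (v · ω) k)
          (fun ω => S.priorErr (e₀ ω) (w · ω) (v · ω) (k + 1)) = S.postCov k * S.Aᵀ := by
        rw [← crossCov_transpose, h.crossCov_priorErr_succ_left (h.squareIntegrable_postErr k),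
          crossCov_comm_eq_zero (h.crossCov_postErr_process k), add_zero, transpose_mul,
          crossCov_transpose, h.crossCov_postErr_self hcov hk]
      rw [h.crossCov_priorErr_succ_left (h.squareIntegrable_priorErr (k + 1)), hpost, hw,
        ← Matrix.mul_assoc]
      rfl
    · intro j hj
      -- Since `j ≤ k`, the innovation at time `j` contains process noises only before time `k`.
      have hw : crossCov μ (fun ω => S.innov (e₀ ω) (w · ω) (v · ω) j) (w k) = 0 := by
        rw [h.crossCov_innov_left (h.process k),
          crossCov_comm_eq_zero (h.process_sensor k j),
          h.crossCov_priorErr_eq_zero (h.process k) (h.init_process k) j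
            (fun i hi => h.process_process_ne i k (hi.trans_le (Nat.le_of_lt_succ hj)).ne)
            (fun i _ => crossCov_comm_eq_zero (h.process_sensor k i))]
        simp
      rw [h.crossCov_priorErr_succ_left (h.squareIntegrable_innov j),
        h.crossCov_postErr_innov_of_priorErr hcov hk horth j (Nat.le_of_lt_succ hj),
        crossCov_comm_eq_zero hw]
      simp

/-- The a posteriori error of the Kalman filter is uncorrelated with all innovations up to the
present. -/
theorem crossCov_postErr_innov (h : S.WhiteNoise μ e₀ w v) (k : ℕ)
    (hinv : ∀ j ≤ k, IsUnit (S.innovCov (S.priorCov j))) :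
    ∀ j ≤ k, crossCov μ (fun ω => S.postErr (e₀ ω) (w · ω) (v · ω) k)
        (fun ω => S.innov (e₀ ω) (w · ω) (v · ω) j) = 0 :=
  have h' := h.crossCov_priorErr k fun j hj => hinv j hj.le
  h.crossCov_postErr_innov_of_priorErr h'.1 (hinv k le_rfl) h'.2

end WhiteNoise

end Subsystem

/-! ### Information of the decision makers -/

theorem Measurable.const_mulVec {Ω : Type*} {H : MeasurableSpace Ω} {m n : ℕ}
    {f : Ω → Fin n → ℝ} (hf : Measurable f) (A : Matrix (Fin m) (Fin n) ℝ) :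
    Measurable fun ω => A *ᵥ f ω :=
  (Continuous.matrix_mulVec continuous_const continuous_id).measurable.comp hf

theorem Measurable.vec_sub {Ω : Type*} {H : MeasurableSpace Ω} {n : ℕ} {f g : Ω → Fin n → ℝ}
    (hf : Measurable f) (hg : Measurable g) : Measurable fun ω => f ω - g ω :=
  hf.sub hg

theorem Measurable.bool_and {Ω : Type*} {H : MeasurableSpace Ω} {f g : Ω → Bool}
    (hf : Measurable f) (hg : Measurable g) : Measurable fun ω => f ω && g ω :=
  (Measurable.of_discrete (f := fun p : Bool × Bool => p.1 && p.2)).comp (hf.prodMk hg)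

namespace Inputs

variable {N : ℕ} {S : Fin N → Subsystem} {Ω : Type*}

/-- The innovation of the sensor's filter of subsystem `i`. -/
noncomputable def innov (ν : Inputs S Ω) (i : Fin N) (κ : ℕ) (ω : Ω) : Fin (S i).p → ℝ :=
  (S i).innov (ν.x0 i ω - (S i).x₀) (fun j => ν.w i j ω) (fun j => ν.v i j ω) κ

/-- The a posteriori error of the sensor's filter of subsystem `i`. -/
noncomputable def postErr (ν : Inputs S Ω) (i : Fin N) (κ : ℕ) (ω : Ω) : Fin (S i).n → ℝ :=
  (S i).postErr (ν.x0 i ω - (S i).x₀) (fun j => ν.w i j ω) (fun j => ν.v i j ω) κ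

variable (P : (i : Fin N) → Matrix (Fin (S i).n) (Fin (S i).n) ℝ) (ν : Inputs S Ω)
  (δ : Fin N → ℕ → Ω → Bool)

/-- Output and innovation differ by a quantity determined by the past, so each can be recovered
causally from the other. This drives both `measurable_innov_info` and `info_le`. -/
theorem output_eq (i : Fin N) (κ : ℕ) (ω : Ω) :
    ν.output P δ i κ ω = ν.innov i κ ω + (S i).C *ᵥ (ν.frame P δ i κ ω).sPrior := by
  rw [innov, ← (S i).loop_y_sub (P i) (ν.x0 i ω) (fun j => ν.w i j ω) (fun j => ν.v i j ω)
    (fun j => ν.recv δ i j ω) κ]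
  simp [output, frame]

theorem sPost_eq (i : Fin N) (κ : ℕ) (ω : Ω) :
    (ν.frame P δ i κ ω).sPost κ (ν.v i κ ω) =
      (ν.frame P δ i κ ω).sPrior + (S i).kalmanGain κ *ᵥ ν.innov i κ ω :=
  (S i).loop_sPost ..

theorem x_sub_sPost (i : Fin N) (κ : ℕ) (ω : Ω) :
    (ν.frame P δ i κ ω).x - (ν.frame P δ i κ ω).sPost κ (ν.v i κ ω) = ν.postErr i κ ω :=
  (S i).loop_x_sub_sPost ..

theorem frame_succ_sPrior (i : Fin N) (κ : ℕ) (ω : Ω) :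
    (ν.frame P δ i (κ + 1) ω).sPrior =
      (S i).A *ᵥ (ν.frame P δ i κ ω).sPost κ (ν.v i κ ω) + (S i).B *ᵥ (S i).fbGain (P i) *ᵥ
        (ν.frame P δ i κ ω).est κ (ν.v i κ ω) (ν.recv δ i κ ω) := rfl

theorem frame_succ_pred (i : Fin N) (κ : ℕ) (ω : Ω) :
    (ν.frame P δ i (κ + 1) ω).pred = ((S i).A + (S i).B * (S i).fbGain (P i)) *ᵥ
      (ν.frame P δ i κ ω).est κ (ν.v i κ ω) (ν.recv δ i κ ω) := rfl

theorem measurable_sPost {H : MeasurableSpace Ω} {i : Fin N} {κ : ℕ}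
    (hs : Measurable fun ω => (ν.frame P δ i κ ω).sPrior) (hz : Measurable (ν.innov i κ)) :
    Measurable fun ω => (ν.frame P δ i κ ω).sPost κ (ν.v i κ ω) := by
  simp only [sPost_eq]
  exact hs.add (hz.const_mulVec _)

/-- The a priori estimates are determined by the earlier innovations and receptions. -/
theorem measurable_sPrior_pred {H : MeasurableSpace Ω} (i : Fin N) (k : ℕ)
    (hz : ∀ κ < k, Measurable (ν.innov i κ)) (hr : ∀ κ < k, Measurable (ν.recv δ i κ)) :
    Measurable (fun ω => (ν.frame P δ i k ω).sPrior) ∧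
      Measurable fun ω => (ν.frame P δ i k ω).pred := by
  induction k with
  | zero => exact ⟨measurable_const, measurable_const⟩
  | succ k ih =>
    obtain ⟨hs, hp⟩ := ih (fun κ hκ => hz κ (hκ.trans k.lt_succ_self))
      (fun κ hκ => hr κ (hκ.trans k.lt_succ_self))
    have hpost := ν.measurable_sPost P δ hs (hz k k.lt_succ_self)
    have hest : Measurable fun ω =>
        (ν.frame P δ i k ω).est k (ν.v i k ω) (ν.recv δ i k ω) :=
      Measurable.ite ((hr k k.lt_succ_self) (measurableSet_singleton true)) hpost hp
    simp only [frame_succ_sPrior, frame_succ_pred]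
    exact ⟨(hpost.const_mulVec _).add ((hest.const_mulVec _).const_mulVec _),
      hest.const_mulVec _⟩

theorem measurable_elapsed {H : MeasurableSpace Ω} (i : Fin N) (k : ℕ)
    (hr : ∀ κ ≤ k, Measurable (ν.recv δ i κ)) : Measurable[H, ⊤] (ν.elapsed δ i k) := by
  -- The elapsed time is a function of finitely many Booleans; on that finite domain every function
  -- is measurable, even into the discrete σ-algebra.
  let g : (Fin (k + 1) → Bool) → ℕ∞ := fun r =>
    ⨅ τ ∈ {τ : ℕ | τ ≤ k ∧ r ⟨k - τ, Nat.lt_succ_of_le (Nat.sub_le k τ)⟩ = true}, (τ : ℕ∞)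
  have hg : Measurable[MeasurableSpace.pi, ⊤] g :=
    @Measurable.of_discrete _ _ _ ⊤ _ _
  have hr' : Measurable fun ω (j : Fin (k + 1)) => ν.recv δ i j ω :=
    measurable_pi_iff.2 fun j => hr j (Nat.le_of_lt_succ j.2)
  have h : ν.elapsed δ i k = g ∘ fun ω (j : Fin (k + 1)) => ν.recv δ i j ω := rfl
  rw [h]
  exact @Measurable.comp _ _ _ _ _ ⊤ _ _ hg hr'

/-- This is how the decision makers read the receptions off the elapsed times. -/
theorem elapsed_eq_zero_iff (i : Fin N) (k : ℕ) (ω : Ω) :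
    ν.elapsed δ i k ω = 0 ↔ ν.recv δ i k ω = true := by
  constructor
  · intro h
    by_contra hr
    have : (1 : ℕ∞) ≤ ν.elapsed δ i k ω := by
      refine le_iInf₂ fun τ hτ => ?_
      obtain rfl | hpos := Nat.eq_zero_or_pos τ
      · exact absurd hτ.2 hr
      · exact_mod_cast hpos
    simp [h] at this
  · intro h
    exact le_antisymm (iInf₂_le_of_le 0 ⟨k.zero_le, h⟩ le_rfl) zero_le

theorem info_mono : Monotone (ν.info P δ) := fun _ _ hkl =>
  iSup_mono fun _ => sup_le_sup
    (biSup_mono fun _ hκ => Nat.le_trans hκ hkl) (biSup_mono fun _ hκ => Nat.lt_of_lt_of_le hκ hkl)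

theorem measurable_output_info (i : Fin N) {κ k : ℕ} (hκ : κ ≤ k) :
    Measurable[ν.info P δ k] (ν.output P δ i κ) :=
  measurable_iff_comap_le.2 <| (le_iSup₂_of_le κ hκ le_rfl).trans <|
    le_sup_left.trans (le_iSup (fun i : Fin N => (⨆ κ ∈ {κ : ℕ | κ ≤ k},
      MeasurableSpace.comap (ν.output P δ i κ) inferInstance) ⊔
        (⨆ κ ∈ {κ : ℕ | κ < k}, MeasurableSpace.comap (ν.elapsed δ i κ) ⊤)) i)

theorem measurable_elapsed_info (i : Fin N) {κ k : ℕ} (hκ : κ < k) :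
    Measurable[ν.info P δ k, ⊤] (ν.elapsed δ i κ) :=
  measurable_iff_comap_le.2 <| (le_iSup₂_of_le κ hκ le_rfl).trans <|
    le_sup_right.trans (le_iSup (fun i : Fin N => (⨆ κ ∈ {κ : ℕ | κ ≤ k},
      MeasurableSpace.comap (ν.output P δ i κ) inferInstance) ⊔
        (⨆ κ ∈ {κ : ℕ | κ < k}, MeasurableSpace.comap (ν.elapsed δ i κ) ⊤)) i)

theorem measurable_recv_info (i : Fin N) {κ k : ℕ} (hκ : κ < k) :
    Measurable[ν.info P δ k] (ν.recv δ i κ) := by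
  refine @measurable_to_bool _ (ν.info P δ k) _ ?_
  have h : ν.recv δ i κ ⁻¹' {true} = ν.elapsed δ i κ ⁻¹' {0} := by
    ext ω
    exact (ν.elapsed_eq_zero_iff δ i κ ω).symm
  rw [h]
  exact ν.measurable_elapsed_info P δ i hκ trivial

/-- The prediction subtracted from the output depends only on earlier innovations and receptions,
which are known by induction. -/
theorem measurable_innov_info (i : Fin N) {κ k : ℕ} (hκ : κ ≤ k) :
    Measurable[ν.info P δ k] (ν.innov i κ) := by
  induction κ using Nat.strong_induction_on with
  | _ κ ih =>
    have hs := (ν.measurable_sPrior_pred P δ (H := ν.info P δ k) i κ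
      (fun j hj => ih j hj (hj.le.trans hκ))
      (fun j hj => ν.measurable_recv_info P δ i (hj.trans_le hκ))).1
    have h : ν.innov i κ = fun ω =>
        ν.output P δ i κ ω - (S i).C *ᵥ (ν.frame P δ i κ ω).sPrior := by
      ext1 ω
      rw [output_eq, add_sub_cancel_right]
    rw [h]
    exact Measurable.vec_sub (ν.measurable_output_info P δ i hκ)
      (hs.const_mulVec _)

/-- The discrepancy `ě_{i,k|k}` is known to the decision makers. -/
theorem measurable_gap_info (i : Fin N) (k : ℕ) : Measurable[ν.info P δ k] (ν.gap P δ i k) := by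
  obtain ⟨hs, hp⟩ := ν.measurable_sPrior_pred P δ (H := ν.info P δ k) i k
    (fun κ hκ => ν.measurable_innov_info P δ i hκ.le)
    (fun κ hκ => ν.measurable_recv_info P δ i hκ)
  exact Measurable.vec_sub
    (ν.measurable_sPost P δ hs (ν.measurable_innov_info P δ i le_rfl)) hp

/-- The information of the decision makers is contained in that of the innovations and the earlier
link states. -/
theorem info_le {H : MeasurableSpace Ω} (k : ℕ) (hz : ∀ i, ∀ κ ≤ k, Measurable (ν.innov i κ))
    (hl : ∀ i, ∀ κ < k, Measurable (ν.link i κ))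
    (hδ : ∀ κ < k, ∀ i, Measurable[ν.info P δ κ] (δ i κ)) : ν.info P δ k ≤ H := by
  induction k using Nat.strong_induction_on with
  | _ k ih =>
    -- Here the circle opens: a decision in frame `κ` depends on the information of frame `κ`, which
    -- the induction hypothesis places inside `H`.
    have hr (i : Fin N) (κ : ℕ) (hκ : κ < k) : Measurable[H] (ν.recv δ i κ) :=
      ((hδ κ hκ i).mono (ih κ hκ (fun i j hj => hz i j (hj.trans hκ.le))
        (fun i j hj => hl i j (hj.trans hκ)) (fun j hj => hδ j (hj.trans hκ))) le_rfl).bool_and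
        (hl i κ hκ)
    refine iSup_le fun i => sup_le (iSup₂_le fun κ hκ => ?_) (iSup₂_le fun κ hκ => ?_)
    · refine measurable_iff_comap_le.1 ?_
      have hκ : κ ≤ k := hκ
      have hs := (ν.measurable_sPrior_pred P δ i κ (fun j hj => hz i j (hj.le.trans hκ))
        (fun j hj => hr i j (hj.trans_le hκ))).1
      have h : ν.output P δ i κ = fun ω =>
          ν.innov i κ ω + (S i).C *ᵥ (ν.frame P δ i κ ω).sPrior := by
        ext1 ω
        rw [output_eq]
      rw [h]
      exact (hz i κ hκ).add (hs.const_mulVec _)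
    · exact measurable_iff_comap_le.1
        (ν.measurable_elapsed δ i κ fun j hj => hr i j (hj.trans_lt hκ))

end Inputs

theorem Measurable.real_add {Ω : Type*} {H : MeasurableSpace Ω} {f g : Ω → ℝ} (hf : Measurable f)
    (hg : Measurable g) : Measurable (f + g) :=
  hf.add hg

theorem Measurable.real_smul {Ω : Type*} {H : MeasurableSpace Ω} {f : Ω → ℝ} (hf : Measurable f)
    (c : ℝ) : Measurable (c • f) :=
  hf.const_smul c

/-! ### Moments of Gaussian vectors -/

section MultivariateGaussian

variable {Ω : Type*} [MeasurableSpace Ω] {μ : Measure Ω} {n : ℕ} {X : Ω → Fin n → ℝ}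
  {m : EuclideanSpace ℝ (Fin n)} {C : Matrix (Fin n) (Fin n) ℝ}

theorem hasGaussianLaw_of_multivariateGaussian
    (h : HasLaw (fun ω => WithLp.toLp 2 (X ω)) (multivariateGaussian m C) μ) :
    HasGaussianLaw X μ :=
  h.hasGaussianLaw.map_equiv (EuclideanSpace.equiv (Fin n) ℝ)

theorem integral_eval_of_multivariateGaussian
    (h : HasLaw (fun ω => WithLp.toLp 2 (X ω)) (multivariateGaussian m C) μ) (a : Fin n) :
    ∫ ω, X ω a ∂μ = m a := by
  have h1 := h.integral_comp (f := fun x => EuclideanSpace.proj (𝕜 := ℝ) a x)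
    (by fun_prop)
  rw [ContinuousLinearMap.integral_comp_comm _ IsGaussian.integrable_fun_id,
    integral_id_multivariateGaussian] at h1
  exact h1

theorem crossCov_of_multivariateGaussian (hC : C.PosSemidef)
    (h : HasLaw (fun ω => WithLp.toLp 2 (X ω)) (multivariateGaussian m C) μ) :
    crossCov μ X X = C := by
  ext a b
  rw [← covariance_eval_multivariateGaussian (μ := m) hC a b]
  exact h.covariance_fun_comp (f := fun x => x a) (g := fun x => x b)
    (Measurable.aemeasurable (by fun_prop)) (Measurable.aemeasurable (by fun_prop))

theorem ProbabilityTheory.HasGaussianLaw.squareIntegrable (h : HasGaussianLaw X μ) :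
    SquareIntegrable μ X :=
  fun a => (h.eval a).memLp_two

theorem hasGaussianLaw_sub_const (h : HasGaussianLaw X μ) (c : Fin n → ℝ) :
    HasGaussianLaw (fun ω => X ω - c) μ := by
  have := h.isGaussian_map
  refine ⟨?_⟩
  have heq : μ.map (fun ω => X ω - c) = (μ.map X).map fun x => x - c := by
    rw [AEMeasurable.map_map_of_aemeasurable (by fun_prop) h.aemeasurable]
    rfl
  rw [heq]
  infer_instance

theorem integral_eval_sub_const [IsProbabilityMeasure μ] (h : HasGaussianLaw X μ) (c : Fin n → ℝ)
    (a : Fin n) : ∫ ω, (X ω - c) a ∂μ = ∫ ω, X ω a ∂μ - c a := by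
  simp only [Pi.sub_apply]
  rw [integral_sub ((h.squareIntegrable a).integrable one_le_two) (integrable_const _)]
  simp

end MultivariateGaussian

/-! ### The noises of the whole network -/

namespace Inputs

variable {N : ℕ} {S : Fin N → Subsystem} {Ω : Type*}

/-- The number of coordinates of the noise that a source produces. -/
def noiseDim (S : Fin N → Subsystem) : Source N → ℕ
  | .init i => (S i).n
  | .process i _ => (S i).n
  | .sensor i _ => (S i).p
  | .link _ _ => 0

/-- The centred real vector that belongs to a value of a source (which is empty for the links). -/
def toNoise (S : Fin N → Subsystem) : (s : Source N) → s.Val S → Fin (noiseDim S s) → ℝ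
  | .init i => fun x => (show Fin (S i).n → ℝ from x) - (S i).x₀
  | .process _ _ => fun x => x
  | .sensor _ _ => fun x => x
  | .link _ _ => fun _ => 0

/-- The centred noise vectors. -/
def noise (ν : Inputs S Ω) (s : Source N) (ω : Ω) : Fin (noiseDim S s) → ℝ :=
  toNoise S s (ν.source s ω)

theorem measurable_toNoise (S : Fin N → Subsystem) (s : Source N) : Measurable (toNoise S s) := by
  cases s with
  | init i =>
    exact (measurable_id.sub_const (S i).x₀ : Measurable fun x : Fin (S i).n → ℝ => x - (S i).x₀)
  | process i k => exact measurable_id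
  | sensor i k => exact measurable_id
  | link i k => exact measurable_const

namespace Model

variable [MeasurableSpace Ω] {ν : Inputs S Ω} {μ : Measure Ω} [IsProbabilityMeasure μ]

theorem hasGaussianLaw_noise (hν : ν.Model μ) (s : Source N) : HasGaussianLaw (ν.noise s) μ := by
  cases s with
  | init i =>
    exact hasGaussianLaw_sub_const (hasGaussianLaw_of_multivariateGaussian (hν.law_init i)) _
  | process i k => exact hasGaussianLaw_of_multivariateGaussian (hν.law_process i k)
  | sensor i k => exact hasGaussianLaw_of_multivariateGaussian (hν.law_sensor i k)
  | link i k =>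
    -- A link contributes a vector of dimension zero, so that the entire family of sources can be
    -- treated as Gaussian.
    have : Subsingleton (Fin (noiseDim S (.link i k)) → ℝ) :=
      inferInstanceAs (Subsingleton (Fin 0 → ℝ))
    exact HasGaussianLaw.of_subsingleton

theorem integral_noise (hν : ν.Model μ) (s : Source N) (a : Fin (noiseDim S s)) :
    ∫ ω, ν.noise s ω a ∂μ = 0 := by
  cases s with
  | init i =>
    have h := hasGaussianLaw_of_multivariateGaussian (hν.law_init i)
    exact (integral_eval_sub_const h (S i).x₀ a).trans
      (sub_eq_zero.2 (integral_eval_of_multivariateGaussian (hν.law_init i) a))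
  | process i k => exact integral_eval_of_multivariateGaussian (hν.law_process i k) a
  | sensor i k => exact integral_eval_of_multivariateGaussian (hν.law_sensor i k) a
  | link i k => exact a.elim0

omit [IsProbabilityMeasure μ] in
theorem iIndepFun_noise (hν : ν.Model μ) : iIndepFun ν.noise μ :=
  hν.indep.comp (toNoise S) (measurable_toNoise S)

theorem crossCov_noise_ne (hν : ν.Model μ) {s t : Source N} (h : s ≠ t) :
    crossCov μ (ν.noise s) (ν.noise t) = 0 :=
  crossCov_eq_zero_of_indepFun (hν.iIndepFun_noise.indepFun h)
    (hν.hasGaussianLaw_noise s).squareIntegrable (hν.hasGaussianLaw_noise t).squareIntegrable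

/-- Independence of distinct sources kills the mixed covariances; the others are those of the
Gaussian laws, centring the initial state being harmless. -/
theorem whiteNoise (hν : ν.Model μ) {i : Fin N} (hS : (S i).Regular) :
    (S i).WhiteNoise μ (ν.noise (.init i)) (fun k => ν.noise (.process i k))
      (fun k => ν.noise (.sensor i k)) where
  init := (hν.hasGaussianLaw_noise (.init i)).squareIntegrable
  process k := (hν.hasGaussianLaw_noise (.process i k)).squareIntegrable
  sensor k := (hν.hasGaussianLaw_noise (.sensor i k)).squareIntegrable
  init_init := by
    have h := hasGaussianLaw_of_multivariateGaussian (hν.law_init i)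
    rw [← crossCov_of_multivariateGaussian hS.psd_X (hν.law_init i)]
    ext a b
    have ha := (h.squareIntegrable a).integrable one_le_two
    have hb := (h.squareIntegrable b).integrable one_le_two
    exact (covariance_sub_const_left ha _).trans (covariance_sub_const_right hb _)
  process_process k := crossCov_of_multivariateGaussian hS.psd_W (hν.law_process i k)
  sensor_sensor k := crossCov_of_multivariateGaussian hS.psd_V (hν.law_sensor i k)
  init_process k := hν.crossCov_noise_ne (s := .init i) (t := .process i k) (by simp)
  init_sensor k := hν.crossCov_noise_ne (s := .init i) (t := .sensor i k) (by simp)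
  process_process_ne j k h :=
    hν.crossCov_noise_ne (s := .process i j) (t := .process i k) (by simpa using h)
  sensor_sensor_ne j k h :=
    hν.crossCov_noise_ne (s := .sensor i j) (t := .sensor i k) (by simpa using h)
  process_sensor j k := hν.crossCov_noise_ne (s := .process i j) (t := .sensor i k) (by simp)

theorem squareIntegrable_postErr (hν : ν.Model μ) {i : Fin N} (hS : (S i).Regular) (k : ℕ) :
    SquareIntegrable μ (ν.postErr i k) :=
  (hν.whiteNoise hS).squareIntegrable_postErr k

theorem squareIntegrable_innov (hν : ν.Model μ) {i : Fin N} (hS : (S i).Regular) (k : ℕ) :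
    SquareIntegrable μ (ν.innov i k) :=
  (hν.whiteNoise hS).squareIntegrable_innov k

/-- The a posteriori error of a sensor is uncorrelated with the innovations of all sensors. -/
theorem crossCov_postErr_innov (hν : ν.Model μ) (hS : ∀ i, (S i).Regular) (i j : Fin N) (k : ℕ)
    (hinv : ∀ κ ≤ k, IsUnit ((S i).innovCov ((S i).priorCov κ))) {κ : ℕ} (hκ : κ ≤ k) :
    crossCov μ (ν.postErr i k) (ν.innov j κ) = 0 := by
  obtain rfl | hij := eq_or_ne i j
  · exact (hν.whiteNoise (hS i)).crossCov_postErr_innov k hinv κ hκ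
  -- For distinct subsystems, no noise source of loop `i` enters the filter of loop `j`.
  have hnoise (s : Source N) (h0 : s ≠ .init j) (hw : ∀ l, s ≠ .process j l)
      (hv : ∀ l, s ≠ .sensor j l) : crossCov μ (ν.noise s) (ν.innov j κ) = 0 :=
    crossCov_comm_eq_zero <| (hν.whiteNoise (hS j)).crossCov_innov_eq_zero
      (hν.hasGaussianLaw_noise s).squareIntegrable (hν.crossCov_noise_ne h0.symm)
      (fun l => hν.crossCov_noise_ne (hw l).symm) (fun l => hν.crossCov_noise_ne (hv l).symm) κ
  exact (hν.whiteNoise (hS i)).crossCov_postErr_eq_zero (hν.squareIntegrable_innov (hS j) κ)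
    (hnoise (.init i) (by simpa using hij) (by simp) (by simp))
    (fun l => hnoise (.process i l) (by simp) (by simp [hij]) (by simp))
    (fun l => hnoise (.sensor i l) (by simp) (by simp) (by simp [hij])) k

end Model

/-! ### Linear span of the noises and σ-algebras of sources -/

/-- The space of the linear combinations of the coordinates of the noises. -/
def noiseSpan (ν : Inputs S Ω) : Submodule ℝ (Ω → ℝ) :=
  Submodule.span ℝ (Set.range fun (p : (s : Source N) × Fin (noiseDim S s)) ω => ν.noise p.1 ω p.2)

theorem noise_mem_noiseSpan (ν : Inputs S Ω) (s : Source N) (a : Fin (noiseDim S s)) :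
    (fun ω => ν.noise s ω a) ∈ ν.noiseSpan :=
  Submodule.subset_span ⟨⟨s, a⟩, rfl⟩

theorem innov_mem_noiseSpan (ν : Inputs S Ω) (i : Fin N) (k : ℕ) (a : Fin (S i).p) :
    (fun ω => ν.innov i k ω a) ∈ ν.noiseSpan :=
  ((S i).filter_mem_submodule (ν.noise_mem_noiseSpan (.init i))
    (fun k => ν.noise_mem_noiseSpan (.process i k))
    (fun k => ν.noise_mem_noiseSpan (.sensor i k)) k).2.1 a

theorem postErr_mem_noiseSpan (ν : Inputs S Ω) (i : Fin N) (k : ℕ) (a : Fin (S i).n) :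
    (fun ω => ν.postErr i k ω a) ∈ ν.noiseSpan :=
  ((S i).filter_mem_submodule (ν.noise_mem_noiseSpan (.init i))
    (fun k => ν.noise_mem_noiseSpan (.process i k))
    (fun k => ν.noise_mem_noiseSpan (.sensor i k)) k).2.2 a

/-- The σ-algebra generated by a set of sources. -/
@[reducible] def sources (ν : Inputs S Ω) (A : Set (Source N)) : MeasurableSpace Ω :=
  ⨆ s ∈ A, MeasurableSpace.comap (ν.source s) inferInstance

theorem measurable_source (ν : Inputs S Ω) {A : Set (Source N)} {s : Source N} (hs : s ∈ A) :
    Measurable[ν.sources A] (ν.source s) :=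
  measurable_iff_comap_le.2 <| le_iSup₂_of_le s hs le_rfl

theorem measurable_noise (ν : Inputs S Ω) {A : Set (Source N)} {s : Source N} (hs : s ∈ A) :
    Measurable[ν.sources A] (ν.noise s) :=
  (measurable_toNoise S s).comp (ν.measurable_source hs)

/-- The sources other than the links. -/
def noiseSources (N : ℕ) : Set (Source N) := {s | ∀ i k, s ≠ .link i k}

theorem measurable_of_mem_noiseSpan {ν : Inputs S Ω} {A : Set (Source N)}
    (hA : noiseSources N ⊆ A) {f : Ω → ℝ} (hf : f ∈ ν.noiseSpan) :
    Measurable[ν.sources A] f := by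
  induction hf using Submodule.span_induction with
  | mem x hx =>
    obtain ⟨⟨s, a⟩, rfl⟩ := hx
    refine (measurable_pi_apply a).comp (ν.measurable_noise (hA ?_))
    rintro i k rfl
    exact a.elim0
  | zero => exact measurable_const
  | add x y _ _ hx hy => exact hx.real_add hy
  | smul c x _ hx => exact hx.real_smul c

end Inputs

theorem measurable_of_eval {Ω ι : Type*} {H : MeasurableSpace Ω} {β : ι → Type*}
    [∀ i, MeasurableSpace (β i)] {f : Ω → (i : ι) → β i}
    (hf : ∀ i, Measurable fun ω => f ω i) : Measurable f :=
  measurable_pi_iff.2 hf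

/-! ### Independence of the sensor's error from the history -/

namespace Inputs

variable {N : ℕ} {S : Fin N → Subsystem} {Ω : Type*}

/-- The innovations of all sensors up to time `k`, coordinatewise. -/
noncomputable def innovs (ν : Inputs S Ω) (k : ℕ) (ω : Ω)
    (p : (j : Fin N) × Fin (k + 1) × Fin (S j).p) : ℝ :=
  ν.innov p.1 p.2.1 ω p.2.2

/-- The states of all links in all frames. -/
def links (ν : Inputs S Ω) (ω : Ω) (p : Fin N × ℕ) : Bool :=
  ν.link p.1 p.2 ω

theorem measurable_postErr_sources (ν : Inputs S Ω) {A : Set (Source N)}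
    (hA : noiseSources N ⊆ A) (i : Fin N) (k : ℕ) : Measurable[ν.sources A] (ν.postErr i k) :=
  measurable_of_eval fun a =>
    measurable_of_mem_noiseSpan hA (ν.postErr_mem_noiseSpan i k a)

theorem measurable_innov_sources (ν : Inputs S Ω) {A : Set (Source N)}
    (hA : noiseSources N ⊆ A) (i : Fin N) (k : ℕ) : Measurable[ν.sources A] (ν.innov i k) :=
  measurable_of_eval fun a =>
    measurable_of_mem_noiseSpan hA (ν.innov_mem_noiseSpan i k a)

theorem measurable_innovs_sources (ν : Inputs S Ω) {A : Set (Source N)}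
    (hA : noiseSources N ⊆ A) (k : ℕ) : Measurable[ν.sources A] (ν.innovs k) :=
  measurable_of_eval fun p =>
    measurable_of_mem_noiseSpan hA (ν.innov_mem_noiseSpan p.1 p.2.1 p.2.2)

/-- The σ-algebra of the innovations up to time `k` and of all link states. -/
@[reducible] noncomputable def history (ν : Inputs S Ω) (k : ℕ) : MeasurableSpace Ω :=
  MeasurableSpace.comap (fun ω => (ν.innovs k ω, ν.links ω)) inferInstance

theorem measurable_innov_history (ν : Inputs S Ω) {κ k : ℕ} (hκ : κ ≤ k) (i : Fin N) :
    Measurable[ν.history k] (ν.innov i κ) :=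
  measurable_of_eval fun a =>
    (measurable_pi_apply (⟨i, ⟨κ, Nat.lt_succ_of_le hκ⟩, a⟩ :
      (j : Fin N) × Fin (k + 1) × Fin (S j).p)).comp
      (measurable_fst.comp (comap_measurable fun ω => (ν.innovs k ω, ν.links ω)))

theorem measurable_link_history (ν : Inputs S Ω) (k κ : ℕ) (i : Fin N) :
    Measurable[ν.history k] (ν.link i κ) :=
  (measurable_pi_apply (i, κ)).comp
    (measurable_snd.comp (comap_measurable fun ω => (ν.innovs k ω, ν.links ω)))

/-- Since `history` does not refer to the decisions, independence can be proved for it and inherited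
by the information. -/
theorem info_le_history (P : (i : Fin N) → Matrix (Fin (S i).n) (Fin (S i).n) ℝ)
    (ν : Inputs S Ω) {δ : Fin N → ℕ → Ω → Bool} {k : ℕ}
    (hδ : ∀ κ < k, ∀ i, Measurable[ν.info P δ κ] (δ i κ)) : ν.info P δ k ≤ ν.history k :=
  ν.info_le P δ k (fun i _ hκ => ν.measurable_innov_history hκ i)
    (fun i κ _ => ν.measurable_link_history k κ i) hδ

/-- The state of a link in frame `k` does not enter the information of the decision makers. -/
theorem info_le_sources (P : (i : Fin N) → Matrix (Fin (S i).n) (Fin (S i).n) ℝ)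
    (ν : Inputs S Ω) {δ : Fin N → ℕ → Ω → Bool} {k : ℕ}
    (hδ : ∀ κ < k, ∀ i, Measurable[ν.info P δ κ] (δ i κ)) (i : Fin N) :
    ν.info P δ k ≤ ν.sources {Source.link i k}ᶜ :=
  ν.info_le P δ k (fun j κ _ => ν.measurable_innov_sources (fun _ hs => hs i k) j κ)
    (fun j κ hκ => ν.measurable_source (s := .link j κ) (by simp [hκ.ne])) hδ

namespace Model

variable [MeasurableSpace Ω] {ν : Inputs S Ω} {μ : Measure Ω}

theorem sources_le (hν : ν.Model μ) (A : Set (Source N)) : ν.sources A ≤ ‹MeasurableSpace Ω› :=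
  iSup₂_le fun s _ => measurable_iff_comap_le.1 (hν.measurable s)

theorem indep_sources (hν : ν.Model μ) {A B : Set (Source N)} (hAB : Disjoint A B) :
    Indep (ν.sources A) (ν.sources B) μ :=
  indep_iSup_of_disjoint (fun s => measurable_iff_comap_le.1 (hν.measurable s)) hν.indep hAB

theorem measurable_postErr (hν : ν.Model μ) (i : Fin N) (k : ℕ) : Measurable (ν.postErr i k) :=
  (ν.measurable_postErr_sources subset_rfl i k).mono (hν.sources_le _) le_rfl

theorem measurable_innovs (hν : ν.Model μ) (k : ℕ) : Measurable (ν.innovs k) :=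
  (ν.measurable_innovs_sources subset_rfl k).mono (hν.sources_le _) le_rfl

theorem measurable_link (hν : ν.Model μ) (i : Fin N) (k : ℕ) : Measurable (ν.link i k) :=
  hν.measurable (.link i k)

theorem measurable_links (hν : ν.Model μ) : Measurable ν.links :=
  measurable_of_eval fun p => hν.measurable_link p.1 p.2

theorem history_le (hν : ν.Model μ) (k : ℕ) : ν.history k ≤ ‹MeasurableSpace Ω› :=
  measurable_iff_comap_le.1 ((hν.measurable_innovs k).prodMk hν.measurable_links)

variable [IsProbabilityMeasure μ]

theorem isGaussianProcess_noise (hν : ν.Model μ) : IsGaussianProcess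
    (fun (p : (s : Source N) × Fin (noiseDim S s)) ω => ν.noise p.1 ω p.2) μ :=
  isGaussianProcess_coord hν.hasGaussianLaw_noise hν.iIndepFun_noise

theorem integral_postErr (hν : ν.Model μ) (i : Fin N) (k : ℕ) (a : Fin (S i).n) :
    ∫ ω, ν.postErr i k ω a ∂μ = 0 :=
  integral_eq_zero_of_mem_span
    (fun p => (hν.isGaussianProcess_noise.hasGaussianLaw_eval p).integrable)
    (fun p => hν.integral_noise p.1 p.2) (ν.postErr_mem_noiseSpan i k a)

/-- The a posteriori error of a sensor is independent of all innovations up to the present. -/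
theorem indepFun_postErr_innovs (hν : ν.Model μ) (hS : ∀ i, (S i).Regular) (i : Fin N) (k : ℕ)
    (hinv : ∀ κ ≤ k, IsUnit ((S i).innovCov ((S i).priorCov κ))) :
    IndepFun (ν.postErr i k) (ν.innovs k) μ := by
  -- Both families lie in the span of one Gaussian process, so they are jointly Gaussian and
  -- vanishing covariances suffice.
  refine IsGaussianProcess.indepFun_of_covariance_eq_zero
    (X := fun a ω => ν.postErr i k ω a) (Y := fun p ω => ν.innovs k ω p)
    (isGaussianProcess_of_mem_span hν.isGaussianProcess_noise ?_)
    (fun a => ((measurable_pi_apply a).comp (hν.measurable_postErr i k)).aemeasurable)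
    (fun p => ((measurable_pi_apply p).comp (hν.measurable_innovs k)).aemeasurable) ?_
  · rintro (a | p)
    · exact ν.postErr_mem_noiseSpan i k a
    · exact ν.innov_mem_noiseSpan p.1 p.2.1 p.2.2
  · rintro a ⟨j, κ, b⟩
    exact congrFun (congrFun
      (hν.crossCov_postErr_innov hS i j k hinv (Nat.le_of_lt_succ κ.2)) a) b

/-- The error and the innovations use only noise sources, while the link states use only the
complementary sources; the links can therefore be adjoined to the innovations. -/
theorem indep_postErr_history (hν : ν.Model μ) (hS : ∀ i, (S i).Regular) (i : Fin N) (k : ℕ)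
    (hinv : ∀ κ ≤ k, IsUnit ((S i).innovCov ((S i).priorCov κ))) :
    IndepFun (ν.postErr i k) (fun ω => (ν.innovs k ω, ν.links ω)) μ := by
  refine indepFun_prodMk_of_indepFun (hν.measurable_postErr i k) (hν.measurable_innovs k)
    hν.measurable_links (hν.indepFun_postErr_innovs hS i k hinv) ?_
  rw [IndepFun_iff_Indep]
  refine indep_of_indep_of_le
    (hν.indep_sources (disjoint_compl_right (a := noiseSources N))) ?_ ?_
  · exact measurable_iff_comap_le.1 ((ν.measurable_postErr_sources subset_rfl i k).prodMk
      (ν.measurable_innovs_sources subset_rfl k))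
  · refine measurable_iff_comap_le.1 (measurable_of_eval fun p => ?_)
    exact ν.measurable_source (s := .link p.1 p.2) (fun h => h p.1 p.2 rfl)

/-- Given the innovations up to the present and all link states, the a posteriori error of a
sensor has mean zero. -/
theorem condExp_postErr (hν : ν.Model μ) (hS : ∀ i, (S i).Regular) (i : Fin N) (k : ℕ)
    (hinv : ∀ κ ≤ k, IsUnit ((S i).innovCov ((S i).priorCov κ))) (a : Fin (S i).n) :
    μ[fun ω => ν.postErr i k ω a | ν.history k] =ᵐ[μ] 0 := by
  have h := condExp_indep_eq (μ := μ) (f := fun ω => ν.postErr i k ω a)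
    (measurable_iff_comap_le.1 (hν.measurable_postErr i k))
    (hν.history_le k)
    ((measurable_pi_apply a).comp (comap_measurable (ν.postErr i k))).stronglyMeasurable
    ((IndepFun_iff_Indep ..).1 (hν.indep_postErr_history hS i k hinv))
  rw [hν.integral_postErr i k a] at h
  exact h

variable {P : (i : Fin N) → Matrix (Fin (S i).n) (Fin (S i).n) ℝ} {δ : Fin N → ℕ → Ω → Bool}
  {k : ℕ}

/-! ### The current link and integrability of the estimates -/

/-- A packet sent in frame `k` is received with probability `q`, given the information of the
decision makers. -/
theorem condExp_link (hν : ν.Model μ) (hδ : ∀ κ < k, ∀ i, Measurable[ν.info P δ κ] (δ i κ))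
    (i : Fin N) :
    μ[fun ω => ((ν.link i k ω).toNat : ℝ) | ν.info P δ k] =ᵐ[μ] fun _ => (S i).q := by
  have hle : ν.info P δ k ≤ ‹MeasurableSpace Ω› := (ν.info_le_history P hδ).trans (hν.history_le k)
  have hm : Measurable[ν.sources {Source.link i k}] fun ω => ((ν.link i k ω).toNat : ℝ) :=
    (Measurable.of_discrete (f := fun b : Bool => (b.toNat : ℝ))).comp
      (ν.measurable_source (A := {Source.link i k}) (s := .link i k) rfl)
  have h := condExp_indep_eq (μ := μ) (hν.sources_le {Source.link i k}) hle hm.stronglyMeasurable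
    (indep_of_indep_of_le_right (hν.indep_sources disjoint_compl_right)
      (ν.info_le_sources P hδ i))
  have hq : ∫ ω, ((ν.link i k ω).toNat : ℝ) ∂μ = (S i).q := by
    have h1 : (fun ω => ((ν.link i k ω).toNat : ℝ)) =
        Set.indicator {ω | ν.link i k ω = true} 1 := by
      ext ω
      by_cases h : ν.link i k ω = true <;> simp [h]
    have h2 : MeasurableSet {ω | ν.link i k ω = true} :=
      hν.measurable_link i k (measurableSet_singleton true)
    rw [h1, integral_indicator_one h2, hν.law_link]
  rw [hq] at h
  exact h

omit [IsProbabilityMeasure μ] in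
theorem q_nonneg (hν : ν.Model μ) (i : Fin N) : 0 ≤ (S i).q := by
  rw [← hν.law_link i 0]
  exact measureReal_nonneg

/-- The estimates are square integrable. -/
theorem squareIntegrable_sPrior_pred (hν : ν.Model μ) {i : Fin N} (hS : (S i).Regular) (k : ℕ)
    (hδ : ∀ κ < k, Measurable (δ i κ)) :
    SquareIntegrable μ (fun ω => (ν.frame P δ i k ω).sPrior) ∧
      SquareIntegrable μ fun ω => (ν.frame P δ i k ω).pred := by
  induction k with
  | zero => exact ⟨fun a => memLp_const _, fun a => memLp_const _⟩
  | succ k ih =>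
    obtain ⟨hs, hp⟩ := ih fun κ hκ => hδ κ (hκ.trans k.lt_succ_self)
    have hpost : SquareIntegrable μ fun ω => (ν.frame P δ i k ω).sPost k (ν.v i k ω) := by
      simp only [sPost_eq]
      exact hs.add ((hν.squareIntegrable_innov hS k).mulVec _)
    have hest : SquareIntegrable μ fun ω =>
        (ν.frame P δ i k ω).est k (ν.v i k ω) (ν.recv δ i k ω) := by
      intro a
      have hset : MeasurableSet {ω | ν.recv δ i k ω = true} :=
        ((hδ k k.lt_succ_self).bool_and (hν.measurable_link i k)) (measurableSet_singleton true)
      refine (((hpost a).indicator hset).add ((hp a).indicator hset.compl)).ae_eq (.of_forall ?_)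
      intro ω
      by_cases h : ν.recv δ i k ω = true <;> simp [Subsystem.Frame.est, h]
    simp only [frame_succ_sPrior, frame_succ_pred]
    exact ⟨(hpost.mulVec _).add ((hest.mulVec _).mulVec _), hest.mulVec _⟩

theorem squareIntegrable_gap (hν : ν.Model μ) {i : Fin N} (hS : (S i).Regular) (k : ℕ)
    (hδ : ∀ κ < k, Measurable (δ i κ)) : SquareIntegrable μ (ν.gap P δ i k) := by
  obtain ⟨hs, hp⟩ := hν.squareIntegrable_sPrior_pred (P := P) hS k hδ
  simp only [SquareIntegrable, gap, sPost_eq]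
  exact (hs.add ((hν.squareIntegrable_innov hS k).mulVec _)).sub hp

end Model

end Inputs

/-! ### Value of information and the objective -/

theorem Subsystem.posSemidef_errWeight {S : Subsystem} {P : Matrix (Fin S.n) (Fin S.n) ℝ}
    (hP : P.PosSemidef) (hR : S.R.PosSemidef) : (S.errWeight P).PosSemidef := by
  have h1 : (S.Bᵀ * P * S.B).PosSemidef := by
    simpa using hP.conjTranspose_mul_mul_same S.B
  simpa [errWeight] using (h1.add hR).conjTranspose_mul_mul_same (S.fbGain P)

namespace Inputs

variable {N : ℕ} {S : Fin N → Subsystem} {Ω : Type*}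
  {P : (i : Fin N) → Matrix (Fin (S i).n) (Fin (S i).n) ℝ} {ν : Inputs S Ω}
  {δ : Fin N → ℕ → Ω → Bool} {k : ℕ}

theorem voi_eq (i : Fin N) (ω : Ω) : ν.voi P δ i k ω =
    ν.gap P δ i k ω ⬝ᵥ ((S i).errWeight (P i) *ᵥ ν.gap P δ i k ω) := by
  rw [voi, Matrix.mul_vecMulVec, Matrix.trace_vecMulVec, dotProduct_comm]

theorem voi_nonneg (hP : ∀ i, (P i).PosSemidef) (hS : ∀ i, (S i).Regular) (i : Fin N) (ω : Ω) :
    0 ≤ ν.voi P δ i k ω := by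
  rw [voi_eq]
  exact (Subsystem.posSemidef_errWeight (hP i) (hS i).psd_R).dotProduct_mulVec_nonneg _

theorem measurable_voi_info (i : Fin N) : Measurable[ν.info P δ k] (ν.voi P δ i k) := by
  have h : Continuous fun g : Fin (S i).n → ℝ => g ⬝ᵥ ((S i).errWeight (P i) *ᵥ g) := by
    fun_prop
  have h1 : ν.voi P δ i k = (fun g : Fin (S i).n → ℝ => g ⬝ᵥ ((S i).errWeight (P i) *ᵥ g)) ∘
      ν.gap P δ i k := by
    ext ω
    exact voi_eq i ω
  rw [h1]
  exact h.measurable.comp (ν.measurable_gap_info P δ i k)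

/-- Insert the sensor's estimate: `x - x̂ = (x - x̂ˢ) + (x̂ˢ - x̂)`, where the second difference
vanishes on reception and is the gap otherwise. -/
theorem err_eq (d : Fin N → Ω → Bool) (i : Fin N) (ω : Ω) (a : Fin (S i).n) :
    ν.err P δ k d i ω a = ν.postErr i k ω a +
      (1 - ((d i ω).toNat : ℝ) * ((ν.link i k ω).toNat : ℝ)) * ν.gap P δ i k ω a := by
  have h := congrFun (ν.x_sub_sPost P δ i k ω) a
  rw [← h]
  cases hd : d i ω <;> cases hl : ν.link i k ω <;>
    simp [err, gap, hd, hl, Subsystem.Frame.est]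

namespace Model

variable [MeasurableSpace Ω] {μ : Measure Ω} [IsProbabilityMeasure μ]

theorem squareIntegrable_err (hν : ν.Model μ) (hS : ∀ i, (S i).Regular)
    (hδ : ∀ κ < k, ∀ i, Measurable (δ i κ)) {d : Fin N → Ω → Bool} {i : Fin N}
    (hd : Measurable (d i)) : SquareIntegrable μ (ν.err P δ k d i) := by
  intro a
  have hset : MeasurableSet {ω | (d i ω && ν.link i k ω) = true} :=
    (hd.bool_and (hν.measurable_link i k)) (measurableSet_singleton true)
  refine ((hν.squareIntegrable_postErr (hS i) k a).add
    ((hν.squareIntegrable_gap (P := P) (hS i) k (fun κ hκ => hδ κ hκ i) a).indicator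
      hset.compl)).ae_eq (.of_forall fun ω => ?_)
  refine Eq.trans ?_ (err_eq d i ω a).symm
  cases hd : d i ω <;> cases hl : ν.link i k ω <;> simp [hd, hl]

/-- The conditional second moments of the error of the estimator. -/
theorem condExp_err_mul_err (hν : ν.Model μ) (hS : ∀ i, (S i).Regular)
    (hδ : ∀ κ < k, ∀ i, Measurable[ν.info P δ κ] (δ i κ)) {d : Fin N → Ω → Bool} {i : Fin N}
    (hd : Measurable[ν.info P δ k] (d i))
    (hinv : ∀ κ ≤ k, IsUnit ((S i).innovCov ((S i).priorCov κ))) (a b : Fin (S i).n) :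
    μ[fun ω => ν.err P δ k d i ω a * ν.err P δ k d i ω b | ν.info P δ k] =ᵐ[μ] fun ω =>
      (μ[fun ω => ν.postErr i k ω a * ν.postErr i k ω b | ν.info P δ k]) ω +
        (1 - ((d i ω).toNat : ℝ) * (S i).q) *
          (ν.gap P δ i k ω a * ν.gap P δ i k ω b) := by
  have hIH := ν.info_le_history P hδ
  have hH := hν.history_le k
  have hI := hIH.trans hH
  have hδ' : ∀ κ < k, ∀ i, Measurable (δ i κ) := fun κ hκ i => (hδ κ hκ i).mono
    ((ν.info_mono P δ hκ.le).trans hI) le_rfl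
  have he := hν.squareIntegrable_postErr (hS i) k
  have hg := hν.squareIntegrable_gap (P := P) (hS i) k fun κ hκ => hδ' κ hκ i
  let c : Ω → ℝ := fun ω => 1 - ((d i ω).toNat : ℝ) * ((ν.link i k ω).toNat : ℝ)
  let D : Ω → ℝ := fun ω => (d i ω).toNat
  let Lk : Ω → ℝ := fun ω => (ν.link i k ω).toNat
  let g (a : Fin (S i).n) : Ω → ℝ := fun ω => ν.gap P δ i k ω a
  let e (a : Fin (S i).n) : Ω → ℝ := fun ω => ν.postErr i k ω a
  have htoNat : Measurable fun p : Bool => (p.toNat : ℝ) := Measurable.of_discrete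
  have hDI : Measurable[ν.info P δ k] D := htoNat.comp hd
  have hLH : Measurable[ν.history k] Lk := htoNat.comp (ν.measurable_link_history k k i)
  have hgI (a) : Measurable[ν.info P δ k] (g a) :=
    (measurable_pi_apply a).comp (ν.measurable_gap_info P δ i k)
  have hcH : Measurable[ν.history k] c :=
    (Measurable.of_discrete (f := fun p : Bool × Bool => 1 - (p.1.toNat : ℝ) * (p.2.toNat : ℝ))).comp
      ((hd.mono hIH le_rfl).prodMk (ν.measurable_link_history k k i))
  have hbool (p : Bool) : ‖(p.toNat : ℝ)‖ ≤ 1 := by cases p <;> simp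
  have hc1 (ω) : ‖c ω‖ ≤ 1 := by
    simp only [c]
    cases d i ω <;> cases ν.link i k ω <;> simp
  -- the cross terms
  have hcross (a b : Fin (S i).n) : Integrable (c * g b * e a) μ ∧
      μ[c * g b * e a | ν.info P δ k] =ᵐ[μ] 0 := by
    have hint : Integrable (c * g b * e a) μ := by
      rw [mul_assoc]
      exact ((hg b).integrable_mul (he a)).bdd_mul
        (hcH.mono hH le_rfl).aestronglyMeasurable (.of_forall hc1)
    refine ⟨hint, ?_⟩
    -- The factor `c` involves the link in frame `k`, so it is not known to the decision makers. It
    -- is known given `history`; conditioning there first and then applying the tower property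
    -- removes the cross terms.
    have hm : StronglyMeasurable[ν.history k] (c * g b) :=
      hcH.stronglyMeasurable.mul ((hgI b).mono hIH le_rfl).stronglyMeasurable
    have h1 : μ[c * g b * e a | ν.history k] =ᵐ[μ] 0 := by
      refine (condExp_mul_of_stronglyMeasurable_left hm hint
        ((he a).integrable one_le_two)).trans ?_
      filter_upwards [hν.condExp_postErr hS i k hinv a] with ω hω
      have hω' : (μ[e a | ν.history k]) ω = 0 := hω
      simp [hω']
    refine (condExp_condExp_of_le hIH hH).symm.trans ?_
    refine (condExp_congr_ae h1).trans ?_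
    rw [condExp_zero]
  -- the reception of the packet
  have hgg : Integrable (g a * g b) μ := (hg a).integrable_mul (hg b)
  have hrecv : Integrable (D * (g a * g b) * Lk) μ ∧
      μ[D * (g a * g b) * Lk | ν.info P δ k] =ᵐ[μ] fun ω => D ω * (S i).q * (g a ω * g b ω) := by
    have hint : Integrable (D * (g a * g b)) μ :=
      hgg.bdd_mul (hDI.mono hI le_rfl).aestronglyMeasurable (.of_forall fun ω => hbool _)
    have hint' : Integrable (D * (g a * g b) * Lk) μ :=
      hint.mul_bdd (hLH.mono hH le_rfl).aestronglyMeasurable (.of_forall fun ω => hbool _)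
    have hL : Integrable Lk μ :=
      Integrable.of_bound (hLH.mono hH le_rfl).aestronglyMeasurable 1 (.of_forall fun ω => hbool _)
    have hm : StronglyMeasurable[ν.info P δ k] (D * (g a * g b)) :=
      hDI.stronglyMeasurable.mul ((hgI a).stronglyMeasurable.mul (hgI b).stronglyMeasurable)
    refine ⟨hint', (condExp_mul_of_stronglyMeasurable_left hm hint' hL).trans ?_⟩
    filter_upwards [hν.condExp_link hδ i] with ω hω
    have hω' : (μ[Lk | ν.info P δ k]) ω = (S i).q := hω
    simp only [Pi.mul_apply, hω']
    ring
  have hee : Integrable (e a * e b) μ := (he a).integrable_mul (he b)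
  -- The square of `c` is `c` itself, as `D` and `Lk` take only the values 0 and 1; hence the last
  -- summand is linear in `Lk`.
  have hsplit : (fun ω => ν.err P δ k d i ω a * ν.err P δ k d i ω b) =
      e a * e b + (c * g b * e a + (c * g a * e b + (g a * g b - D * (g a * g b) * Lk))) := by
    ext ω
    simp only [err_eq, Pi.add_apply, Pi.mul_apply, Pi.sub_apply, c, D, Lk, g, e]
    cases d i ω <;> cases ν.link i k ω <;> simp <;> ring
  rw [hsplit]
  have h3 : Integrable (g a * g b - D * (g a * g b) * Lk) μ := hgg.sub hrecv.1
  have h2 : Integrable (c * g a * e b + (g a * g b - D * (g a * g b) * Lk)) μ :=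
    (hcross b a).1.add h3
  have hself : μ[g a * g b | ν.info P δ k] = g a * g b := condExp_of_stronglyMeasurable hI
    ((hgI a).stronglyMeasurable.mul (hgI b).stronglyMeasurable) hgg
  filter_upwards [condExp_add hee ((hcross a b).1.add h2) (ν.info P δ k),
    condExp_add (hcross a b).1 h2 (ν.info P δ k), condExp_add (hcross b a).1 h3 (ν.info P δ k),
    condExp_sub hgg hrecv.1 (ν.info P δ k), (hcross a b).2, (hcross b a).2,
    hrecv.2] with ω e1 e2 e3 e4 e5 e6 e7
  rw [e1, Pi.add_apply, e2, Pi.add_apply, e3, Pi.add_apply, e4, Pi.sub_apply, e5, e6, e7, hself]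
  rw [show e a * e b = fun ω => ν.postErr i k ω a * ν.postErr i k ω b from rfl]
  simp only [Pi.zero_apply, Pi.mul_apply, D, g]
  ring

/-- Up to a part that the decision does not influence, the objective is the value of information
of the subsystems weighted with the probabilities that no packet is received. -/
theorem cost_eq (hν : ν.Model μ) (hS : ∀ i, (S i).Regular)
    (hδ : ∀ κ < k, ∀ i, Measurable[ν.info P δ κ] (δ i κ))
    (hinv : ∀ i, ∀ κ ≤ k, IsUnit ((S i).innovCov ((S i).priorCov κ)))
    {d : Fin N → Ω → Bool} (hd : ∀ i, Measurable[ν.info P δ k] (d i)) :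
    ν.cost P δ μ k d =ᵐ[μ] fun ω =>
      ∑ i, ((P i * (S i).W).trace + ((S i).errWeight (P i) * Matrix.of fun a b =>
        (μ[fun ω => ν.postErr i k ω a * ν.postErr i k ω b | ν.info P δ k]) ω).trace +
        ν.voi P δ i k ω) - ∑ i, ((d i ω).toNat : ℝ) * (ν.voi P δ i k ω * (S i).q) := by
  have h := fun i a b => hν.condExp_err_mul_err hS hδ (hd i) (hinv i) a b
  simp only [Filter.EventuallyEq, ← ae_all_iff] at h
  filter_upwards [h] with ω hω
  rw [cost, ← Finset.sum_sub_distrib]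
  refine Finset.sum_congr rfl fun i _ => ?_
  have hM : (Matrix.of fun a b => (μ[fun ω' => ν.err P δ k d i ω' a * ν.err P δ k d i ω' b |
      ν.info P δ k]) ω) = (Matrix.of fun a b =>
        (μ[fun ω => ν.postErr i k ω a * ν.postErr i k ω b | ν.info P δ k]) ω) +
        (1 - ((d i ω).toNat : ℝ) * (S i).q) •
          vecMulVec (ν.gap P δ i k ω) (ν.gap P δ i k ω) := by
    ext a b
    simp [hω i a b, vecMulVec_apply]
  rw [hM, Matrix.mul_add, Matrix.mul_smul, Matrix.trace_add, Matrix.trace_smul, ← voi, smul_eq_mul]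
  ring

end Model

/-! ### Optimality and existence of the maximizing decision -/

/-- Among the decisions that grant access to at most one triggered subsystem, those that grant it
to a maximizer of `VoI q` gain most. -/
theorem sum_voi_le {θ : Fin N → ℕ → Ω → Bool} {d d' : Fin N → Ω → Bool}
    (hnonneg : ∀ i ω, 0 ≤ ν.voi P δ i k ω * (S i).q) (hd' : ν.Feasible P δ θ k d')
    (hmax : ν.GrantsMaxVoI P δ θ k d) (ω : Ω) :
    ∑ i, ((d' i ω).toNat : ℝ) * (ν.voi P δ i k ω * (S i).q) ≤
      ∑ i, ((d i ω).toNat : ℝ) * (ν.voi P δ i k ω * (S i).q) := by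
  have hpos (i : Fin N) : 0 ≤ ((d i ω).toNat : ℝ) * (ν.voi P δ i k ω * (S i).q) :=
    mul_nonneg (Nat.cast_nonneg _) (hnonneg i ω)
  by_cases h : ∃ i, d' i ω = true
  · obtain ⟨i, hi⟩ := h
    have hθ := hd'.triggered i ω hi
    obtain ⟨j, -, hj, hdj⟩ := hmax ω ⟨i, hθ⟩
    have hone : ∀ l ≠ i, d' l ω = false := by
      intro l hl
      by_contra hl'
      have h1 := Finset.sum_le_sum_of_subset (f := fun i => (d' i ω).toNat)
        (Finset.subset_univ {l, i})
      rw [Finset.sum_pair hl] at h1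
      have h2 := hd'.collision_free ω
      simp only [Bool.not_eq_false] at hl'
      simp only [hi, hl', Bool.toNat_true] at h1
      omega
    calc ∑ i, ((d' i ω).toNat : ℝ) * (ν.voi P δ i k ω * (S i).q)
        = ν.voi P δ i k ω * (S i).q := by
          rw [Finset.sum_eq_single i (fun l _ hl => by simp [hone l hl]) (by simp)]
          simp [hi]
      _ ≤ ν.voi P δ j k ω * (S j).q := hj hθ
      _ = ((d j ω).toNat : ℝ) * (ν.voi P δ j k ω * (S j).q) := by simp [hdj]
      _ ≤ _ := Finset.single_le_sum (fun i _ => hpos i) (Finset.mem_univ j)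
  -- A decision that grants no access gains nothing, whereas every other gain is nonnegative.
  · push Not at h
    rw [Finset.sum_eq_zero fun i _ => by simp [Bool.eq_false_iff.2 (h i)]]
    exact Finset.sum_nonneg fun i _ => hpos i

theorem measurableSet_forall {H : MeasurableSpace Ω} {ι : Sort*} [Countable ι] {p : ι → Ω → Prop}
    (h : ∀ i, MeasurableSet {ω | p i ω}) : MeasurableSet {ω | ∀ i, p i ω} := by
  rw [Set.ofPred_forall]
  exact MeasurableSet.iInter h

theorem measurable_decide {H : MeasurableSpace Ω} {p : Ω → Prop} [DecidablePred p]
    (h : MeasurableSet {ω | p ω}) : Measurable fun ω => decide (p ω) := by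
  refine measurable_to_bool ?_
  convert h using 1
  ext ω
  simp

/-- The first among the triggered subsystems that maximize `VoI q` may be granted access. -/
theorem exists_feasible_grantsMaxVoI {θ : Fin N → ℕ → Ω → Bool}
    (hθ : ∀ i, Measurable[ν.info P δ k] (θ i k)) :
    ∃ d, ν.Feasible P δ θ k d ∧ ν.GrantsMaxVoI P δ θ k d := by
  classical
  let best (i : Fin N) (ω : Ω) : Prop := θ i k ω = true ∧
    ∀ j, θ j k ω = true → ν.voi P δ j k ω * (S j).q ≤ ν.voi P δ i k ω * (S i).q
  -- Breaking ties by the smallest index ensures a single transmitter and a measurable selection.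
  let first (i : Fin N) (ω : Ω) : Prop := best i ω ∧ ∀ j < i, ¬ best j ω
  have hbest (i : Fin N) : MeasurableSet[ν.info P δ k] {ω | best i ω} := by
    have hset (j : Fin N) : MeasurableSet[ν.info P δ k] {ω | θ j k ω = true} :=
      hθ j (measurableSet_singleton true)
    have hval (j : Fin N) : Measurable[ν.info P δ k] fun ω => ν.voi P δ j k ω * (S j).q :=
      (measurable_mul_const (S j).q).comp (measurable_voi_info j)
    refine (hset i).inter ?_
    refine measurableSet_forall fun j => ?_
    have : {ω | θ j k ω = true → ν.voi P δ j k ω * (S j).q ≤ ν.voi P δ i k ω * (S i).q} =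
        {ω | θ j k ω = true}ᶜ ∪ {ω | ν.voi P δ j k ω * (S j).q ≤ ν.voi P δ i k ω * (S i).q} := by
      ext ω
      exact imp_iff_not_or
    rw [this]
    exact (hset j).compl.union (measurableSet_le (hval j) (hval i))
  have hfirst (i : Fin N) : MeasurableSet[ν.info P δ k] {ω | first i ω} := by
    refine (hbest i).inter ?_
    exact measurableSet_forall fun j => measurableSet_forall fun _ => (hbest j).compl
  have huniq (ω : Ω) (i j : Fin N) (hi : first i ω) (hj : first j ω) : i = j := by
    rcases lt_trichotomy i j with h | h | h
    · exact absurd hi.1 (hj.2 i h)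
    · exact h
    · exact absurd hj.1 (hi.2 j h)
  refine ⟨fun i ω => decide (first i ω), ⟨fun i => measurable_decide (hfirst i), fun i ω h => ?_,
    fun ω => ?_⟩, fun ω hne => ?_⟩
  · exact (of_decide_eq_true h).1.1
  · by_cases h : ∃ i, first i ω
    · obtain ⟨i, hi⟩ := h
      rw [Finset.sum_eq_single i]
      · exact Bool.toNat_le _
      · intro j _ hj
        simp [show ¬ first j ω from fun h => hj (huniq ω j i h hi)]
      · simp
    · push Not at h
      simp [h]
  · obtain ⟨i, hi, hmax⟩ := Set.exists_max_image (triggeredSet θ k ω)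
      (fun j => ν.voi P δ j k ω * (S j).q) (Set.toFinite _) hne
    have hex : (Finset.univ.filter fun i => best i ω).Nonempty :=
      ⟨i, Finset.mem_filter.2 ⟨Finset.mem_univ i, hi, fun j hj => hmax j hj⟩⟩
    have hmem := (Finset.mem_filter.1 (Finset.min'_mem _ hex)).2
    refine ⟨_, hmem.1, fun j hj => hmem.2 j hj, decide_eq_true ⟨hmem, fun j hj hb => ?_⟩⟩
    exact absurd (Finset.min'_le _ j (Finset.mem_filter.2 ⟨Finset.mem_univ j, hb⟩)) hj.not_ge

end Inputs

theorem proposition2 {N : ℕ} (S : Fin N → Subsystem) (hS : ∀ i, (S i).Regular)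
    (P : (i : Fin N) → Matrix (Fin (S i).n) (Fin (S i).n) ℝ)
    (hP : ∀ i, (S i).IsControlRiccati (P i))
    (Pbar : (i : Fin N) → Matrix (Fin (S i).n) (Fin (S i).n) ℝ)
    (hPbar : ∀ i, (S i).IsSteadyCov (Pbar i))
    {Ω : Type*} [MeasurableSpace Ω] (μ : Measure Ω) [IsProbabilityMeasure μ]
    (ν : Inputs S Ω) (hν : ν.Model μ)
    (k : ℕ)
    (hinv : ∀ i, ∀ κ ≤ k, IsUnit ((S i).innovCov ((S i).priorCov κ)))
    (hsteady : ∀ i, (S i).postCov k = Pbar i)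
    (θ δ : Fin N → ℕ → Ω → Bool)
    (hθ : ∀ κ ≤ k, ∀ i, Measurable[ν.info P δ κ] (θ i κ))
    (hδ : ∀ κ < k, ν.Feasible P δ θ κ (fun i => δ i κ)) :
    (∃ d, ν.Feasible P δ θ k d ∧ ν.GrantsMaxVoI P δ θ k d) ∧
      ∀ d, ν.Feasible P δ θ k d → ν.GrantsMaxVoI P δ θ k d → ν.Solves P δ μ θ k d := by
  have hδ' : ∀ κ < k, ∀ i, Measurable[ν.info P δ κ] (δ i κ) := fun κ hκ => (hδ κ hκ).measurable
  have hI := (ν.info_le_history P hδ').trans (hν.history_le k)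
  refine ⟨Inputs.exists_feasible_grantsMaxVoI (hθ k le_rfl), fun d hd hmax => ⟨hd, fun d' hd' =>
    ⟨fun i a b => ?_, ?_⟩⟩⟩
  · have h := hν.squareIntegrable_err (P := P) (k := k) hS
      (fun κ hκ i => (hδ' κ hκ i).mono ((ν.info_mono P δ hκ.le).trans hI) le_rfl)
      ((hd'.measurable i).mono hI le_rfl)
    exact (h a).integrable_mul (h b)
  · filter_upwards [hν.cost_eq hS hδ' hinv hd.measurable,
      hν.cost_eq hS hδ' hinv hd'.measurable] with ω h1 h2
    -- The two objectives share their first sum, so only the weighted values of information are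
    -- compared.
    rw [h1, h2]
    exact sub_le_sub_left (Inputs.sum_voi_le (fun i ω => mul_nonneg
      (Inputs.voi_nonneg (fun i => (hP i).1) hS i ω) (hν.q_nonneg i)) hd' hmax ω) _
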